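/- Let $F(x,y)=h_nx^n+h_kx^ky^{n-k}+h_0y^n$ with $n\ge 6$, $0<k<n$ and nonzero integers $h_n,h_k,h_0$ be a trinomial form that is irreducible in $\mathbb{Z}[x,y]$. Put $f(x)=F(x,1)$ and $H=\max(|h_n|,|h_k|,|h_0|)$. Let $\chi_n,\pi_n\ge 0$ be real numbers, and put $Y_F=H^{\chi_n}e^{\pi_n}$. A critical point $\tau\in\mathbb{R}$ of $f$ is *proper* if $f''f>0$ on a punctured neighbourhood of $\tau$, and *improper* otherwise. The *exceptional points* of $f$ are its real roots and its proper critical points; list them as $\tau_1<\dots<\tau_c$. Choose improper critical points $\eta_1,\dots,\eta_{c-1}$ with $\tau_1<\eta_1<\tau_2<\dots<\eta_{c-1}<\tau_c$, and set $\eta_0=-\infty$, $\eta_c=+\infty$. A real number $\rho$ *belongs to* $\tau_i$ if $\eta_{i-1}\le\rho<\eta_i$. Let $p_0(n)=3$ if $6\le n\le 8$ and $p_0(n)=2$ if $n\ge 9$. A *special solution* is a pair $(p,q)\in\mathbb{Z}^2$ with $|F(p,q)|=1$, $p>q\ge 1$ and $p\ge p_0(n)$; it is *small* if $q\le Y_F$.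 Put $n^*=\frac{n-2}{2}$ and, for real $d$, \[K_d(n)=m_n\,(r_n(1+u_n))^d,\quad m_n=2\sqrt{\tfrac{2n}{(n-1)(n-2)}},\quad r_n=(2.032)^{1/n},\quad u_n=\sqrt{\tfrac{2}{(n-2)\,p_0(n)^n}}.\] Let $d_0,d$ be real numbers with $0\le d_0\le n^*-1.4$ and $1<d\le n^*$, put $Q_1=p_0(n)^{n^*-d_0}/K_{d_0}(n)$, and assume that $Q_1^{d-1}>\max(1,K_d(n))$. Let $\alpha>1$ be a real root of $f$. Then there are at most \[T=\left\lfloor\max\left(\frac{\log\left(\frac{\chi_n}{\frac{d_0(d-1)+d}{n(d-1)}}+1\right)}{\log d},\ \frac{\log\left(\frac{\pi_n}{\log\left(K_d(n)^{-\frac{1}{d-1}}Q_1\right)}+1\right)}{\log d}\right)\right\rfloor+2\] small special solutions $(p,q)$ for which $p/q$ belongs to $\alpha$. This holds for every choice of the $\eta_i$. -/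

import Mathlib

noncomputable section

namespace TrinomialThue

open Polynomial Topology

/-! ### The trinomial form, its height, and its dehomogenization -/

/-- The binary form `F(x, y) = hn xⁿ + hk xᵏ yⁿ⁻ᵏ + h0 yⁿ`; variable `0` is `x`, variable `1`
is `y`. -/
def form (n k : ℕ) (hn hk h0 : ℤ) : MvPolynomial (Fin 2) ℤ :=
  MvPolynomial.C hn * MvPolynomial.X 0 ^ n
    + MvPolynomial.C hk * MvPolynomial.X 0 ^ k * MvPolynomial.X 1 ^ (n - k)
    + MvPolynomial.C h0 * MvPolynomial.X 1 ^ n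

/-- The naive height `H = max(|hn|, |hk|, |h0|)`. -/
def height (hn hk h0 : ℤ) : ℤ := max |hn| (max |hk| |h0|)

/-- The polynomial `f(x) = F(x, 1)`, with real coefficients. -/
def dehom (F : MvPolynomial (Fin 2) ℤ) : ℝ[X] :=
  MvPolynomial.aeval ![(X : ℝ[X]), 1] F

/-! ### Exceptional points, and the intervals belonging to them -/

/-- `τ` is a critical point of `g`. -/
def IsCriticalPoint (g : ℝ[X]) (τ : ℝ) : Prop := (derivative g).eval τ = 0

/-- `τ` is a proper critical point of `g`: a critical point such that `g'' g > 0` on some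
punctured neighbourhood of `τ`. -/
def IsProperCriticalPoint (g : ℝ[X]) (τ : ℝ) : Prop :=
  IsCriticalPoint g τ ∧
    ∃ U ∈ 𝓝 τ, ∀ x ∈ U \ {τ}, 0 < (derivative (derivative g)).eval x * g.eval x

/-- A critical point that is not proper. -/
def IsImproperCriticalPoint (g : ℝ[X]) (τ : ℝ) : Prop :=
  IsCriticalPoint g τ ∧ ¬ IsProperCriticalPoint g τ

/-- An exceptional point of `g`: a real root or a proper critical point. -/
def IsExceptionalPoint (g : ℝ[X]) (τ : ℝ) : Prop :=
  g.eval τ = 0 ∨ IsProperCriticalPoint g τ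

/-- `τ` lists the exceptional points of `g` in increasing order, and
`-∞ = η 0 < η 1 < ⋯ < η c = +∞` is a choice of separators: each `η i` with `0 < i < c` is an
improper critical point lying strictly between the two neighbouring exceptional points. -/
structure IsExceptionalPartition (g : ℝ[X]) {c : ℕ} (τ : Fin c → ℝ) (η : Fin (c + 1) → EReal) :
    Prop where
  strictMono : StrictMono τ
  range_eq : Set.range τ = {x | IsExceptionalPoint g x}
  first : η 0 = ⊥
  last : η (Fin.last c) = ⊤
  separates : ∀ (i : ℕ) (hi : i + 1 < c), ∃ e : ℝ,
    η ⟨i + 1, by omega⟩ = (e : EReal) ∧ IsImproperCriticalPoint g e ∧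
      τ ⟨i, by omega⟩ < e ∧ e < τ ⟨i + 1, hi⟩

/-- `ρ` belongs to the `i`-th exceptional point: `ρ` lies in the interval from `η i` (included,
if finite) to `η (i + 1)` (excluded). -/
def BelongsTo {c : ℕ} (η : Fin (c + 1) → EReal) (i : Fin c) (ρ : ℝ) : Prop :=
  η i.castSucc ≤ (ρ : EReal) ∧ (ρ : EReal) < η i.succ

/-! ### Special solutions -/

/-- `p₀(n)`: equal to `3` for `6 ≤ n ≤ 8` and to `2` for `n ≥ 9`. -/
def p₀ (n : ℕ) : ℕ := if n ≤ 8 then 3 else 2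

/-- A special solution `(p, q)` of `|F(x, y)| = 1`. -/
structure IsSpecialSolution (n : ℕ) (F : MvPolynomial (Fin 2) ℤ) (p q : ℤ) : Prop where
  eqn : |MvPolynomial.eval ![p, q] F| = 1
  one_le : 1 ≤ q
  lt : q < p
  p₀_le : (p₀ n : ℤ) ≤ p

/-- `Y_F = H^χ e^π`. -/
def Y (H χ ϖ : ℝ) : ℝ := H ^ χ * Real.exp ϖ

/-- The small special solutions `(p, q)` (those with `q ≤ Y_F`) of `|F(x, y)| = 1`, where
`F = hn xⁿ + hk xᵏ yⁿ⁻ᵏ + h0 yⁿ`, for which `p / q` belongs to the `i`-th exceptional point. -/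
def smallSpecialSolutions (n k : ℕ) (hn hk h0 : ℤ) (χ ϖ : ℝ) {c : ℕ}
    (η : Fin (c + 1) → EReal) (i : Fin c) : Set (ℤ × ℤ) :=
  {s | IsSpecialSolution n (form n k hn hk h0) s.1 s.2 ∧
    (s.2 : ℝ) ≤ Y (height hn hk h0 : ℝ) χ ϖ ∧ BelongsTo η i ((s.1 : ℝ) / (s.2 : ℝ))}

/-! ### The constants -/

/-- `n* = (n - 2) / 2`. -/
def nStar (n : ℕ) : ℝ := ((n : ℝ) - 2) / 2

/-- `m_n = 2 √(2n / ((n - 1)(n - 2)))`. -/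
def m (n : ℕ) : ℝ := 2 * Real.sqrt (2 * n / (((n : ℝ) - 1) * ((n : ℝ) - 2)))

/-- `r_n = 2.032^(1/n)`. -/
def r (n : ℕ) : ℝ := (2.032 : ℝ) ^ (1 / (n : ℝ))

/-- `u_n = √(2 / ((n - 2) p₀(n)^n))`. -/
def u (n : ℕ) : ℝ := Real.sqrt (2 / (((n : ℝ) - 2) * (p₀ n : ℝ) ^ n))

/-- `K_d(n) = m_n (r_n (1 + u_n))^d`. -/
def K (d : ℝ) (n : ℕ) : ℝ := m n * (r n * (1 + u n)) ^ d

/-- `Q₁ = p₀(n)^(n* - d₀) / K_{d₀}(n)`. -/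
def Q₁ (d₀ : ℝ) (n : ℕ) : ℝ := (p₀ n : ℝ) ^ (nStar n - d₀) / K d₀ n

/-- The bound `T`. -/
def T (n : ℕ) (d₀ d χ ϖ : ℝ) : ℤ :=
  ⌊max (Real.log (χ / ((d₀ * (d - 1) + d) / (n * (d - 1))) + 1) / Real.log d)
      (Real.log (ϖ / Real.log (K d n ^ (-1 / (d - 1)) * Q₁ d₀ n) + 1) / Real.log d)⌋ + 2

end TrinomialThue

end

/-!
Let `f = a x ^ n + b x ^ k + c` be the dehomogenized form, normalized so that `a > 0`. Since
`f'(x)` is `x ^ (k - 1)` times an increasing function on `[0, ∞)`, there is at most one positive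
critical point `x₀`. The separators are critical points, so if `ρ = p / q` belongs to the root
`α > 1` and `|f(ρ)| = q ^ (-n)`, then `α` and `ρ` lie on the same side of `x₀`
(`monoSide_of_belongsTo`).

On one side of `x₀`, `|f'(x)|` is at least a multiple of the distance from `x` to the end of the
interval nearest to `x₀`, whence `|f(ρ)|` is bounded below by a multiple of `(ρ - α) ^ 2`. The
multiple may be taken from the leading term, about `n ρ ^ (n - 2) / 2`, or, because at a root the
height is controlled by the nonconstant terms, to be about `(n - 1) H / (4 ρ ^ 2)`. This gives two
upper bounds for `|ρ - α|` (`sq_sub_root_le`, `height_mul_sq_sub_root_le`), whose weighted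
geometric mean is
`|ρ - α| ≤ (m_n / 2) r_n ^ d H ^ (-d / n) p ^ (d - n*) q ^ (-1 - d)` for `0 ≤ d ≤ n*`
(`abs_sub_root_le_exp_logBound`).

Distinct solutions are distinct reduced fractions, so `1 / (q q') ≤ |ρ - ρ'|`, and for `q ≤ q'` the
estimate yields `q' ≥ p ^ (n* - d) q ^ d H ^ (d / n) / K_d(n)` (`gap_principle`). Using this once
with `d₀` and `p ≥ p₀(n)`, and then repeatedly with `d`, makes the denominators grow doubly
exponentially (`chain_bound`); the bound `q ≤ H ^ χ e ^ π` then limits their number.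
-/

namespace TrinomialThue

open Set Polynomial

/-! ### A quadratic lower bound from the derivative -/

theorem half_mul_sq_le_sub_of_le_deriv {g g' : ℝ → ℝ} {lo hi C : ℝ} (h : lo ≤ hi)
    (hg : ∀ x, HasDerivAt g (g' x) x) (hb : ∀ x ∈ Icc lo hi, C * (x - lo) ≤ g' x) :
    C / 2 * (hi - lo) ^ 2 ≤ g hi - g lo := by
  have hd : ∀ x, HasDerivAt (fun x => g x - C / 2 * (x - lo) ^ 2) (g' x - C * (x - lo)) x := by
    intro x
    have h2 := (((hasDerivAt_id x).sub_const lo).pow 2).const_mul (C / 2)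
    refine ((hg x).sub h2).congr_deriv ?_
    simp
    ring
  have hm : MonotoneOn (fun x => g x - C / 2 * (x - lo) ^ 2) (Icc lo hi) := by
    refine monotoneOn_of_deriv_nonneg (convex_Icc lo hi)
      (fun x _ => (hd x).continuousAt.continuousWithinAt)
      (fun x _ => (hd x).differentiableAt.differentiableWithinAt) fun x hx => ?_
    rw [(hd x).deriv]
    linarith [hb x (interior_subset hx)]
  have := hm (left_mem_Icc.2 h) (right_mem_Icc.2 h) h
  simp only [sub_self] at this
  nlinarith

/-- If `|g'|` grows at least linearly away from one of the endpoints of an interval, with constant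
sign, then the increment of `g` is at least quadratic in the length. The two alternatives are
swapped by the reflection `x ↦ lo + hi - x`. -/
theorem half_mul_sq_le_abs_sub {g g' : ℝ → ℝ} {lo hi C : ℝ} (h : lo ≤ hi)
    (hg : ∀ x, HasDerivAt g (g' x) x)
    (hb : (∀ x ∈ Icc lo hi, C * (x - lo) ≤ g' x) ∨ ∀ x ∈ Icc lo hi, C * (hi - x) ≤ -g' x) :
    C / 2 * (hi - lo) ^ 2 ≤ |g hi - g lo| := by
  rcases hb with hb | hb
  · exact (half_mul_sq_le_sub_of_le_deriv h hg hb).trans (le_abs_self _)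
  · have := half_mul_sq_le_sub_of_le_deriv (g := fun x => g (lo + hi - x))
      (g' := fun x => -g' (lo + hi - x)) (C := C) h
      (fun x => (hg (lo + hi - x)).comp_const_sub (lo + hi) x)
      (fun x hx => by
        have := hb (lo + hi - x) ⟨by linarith [hx.2], by linarith [hx.1]⟩
        calc C * (x - lo) = C * (hi - (lo + hi - x)) := by ring
          _ ≤ _ := this)
    rw [abs_sub_comm]
    refine le_trans ?_ (le_abs_self _)
    simpa using this

/-- The convexity of `x ↦ x ^ (l + 1)` on `[0, ∞)`: its graph lies above its tangent at `y`. -/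
theorem mul_pow_mul_sub_le_pow_sub_pow {x y : ℝ} (l : ℕ) (hy : 0 ≤ y) (hxy : y ≤ x) :
    (l + 1) * y ^ l * (x - y) ≤ x ^ (l + 1) - y ^ (l + 1) := by
  induction l with
  | zero => simp
  | succ l ih =>
    push_cast
    have h1 : y ^ (l + 1) ≤ x ^ (l + 1) := pow_le_pow_left₀ hy hxy _
    have h2 := mul_le_mul_of_nonneg_right ih hy
    have h3 := mul_le_mul_of_nonneg_right h1 (sub_nonneg.2 hxy)
    calc ((l : ℝ) + 1 + 1) * y ^ (l + 1) * (x - y)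
        = (l + 1) * y ^ l * (x - y) * y + y ^ (l + 1) * (x - y) := by ring
      _ ≤ (x ^ (l + 1) - y ^ (l + 1)) * y + x ^ (l + 1) * (x - y) := add_le_add h2 h3
      _ = _ := by ring

/-! ### Trinomials on an interval of monotonicity -/

/-- The real trinomial `a x ^ n + b x ^ (k + 1) + c` of degree `n = k + l + 2`. Writing the
exponents in terms of `k` and `l` keeps all subtractions out of them. -/
def tri (a b c : ℝ) (k l : ℕ) (x : ℝ) : ℝ := a * x ^ (k + l + 2) + b * x ^ (k + 1) + c

/-- The derivative of `tri a b c k l` divided by `x ^ k`. For `a > 0` it is strictly increasing on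
`[0, ∞)`, so it has at most one positive zero, the only positive critical point of the trinomial. -/
def slope (a b : ℝ) (k l : ℕ) (x : ℝ) : ℝ := (k + l + 2) * a * x ^ (l + 1) + (k + 1) * b

theorem hasDerivAt_tri (a b c : ℝ) (k l : ℕ) (x : ℝ) :
    HasDerivAt (tri a b c k l) (x ^ k * slope a b k l x) x := by
  have h1 := (hasDerivAt_pow (k + l + 2) x).const_mul a
  have h2 := (hasDerivAt_pow (k + 1) x).const_mul b
  refine ((h1.add h2).add_const c).congr_deriv ?_
  simp only [slope, Nat.add_sub_cancel, show k + l + 2 - 1 = k + (l + 1) by omega, pow_add]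
  push_cast
  ring

/-- The interval `[lo, hi]` does not contain the positive critical point of the trinomial in its
interior: either the trinomial increases on `[lo, ∞)`, or it decreases on `[0, hi]`. (Stated for
`a > 0` and `0 ≤ lo ≤ hi`; by the monotonicity of `slope` a condition at one endpoint suffices.) -/
def MonoSide (a b : ℝ) (k l : ℕ) (lo hi : ℝ) : Prop :=
  0 ≤ slope a b k l lo ∨ slope a b k l hi ≤ 0

theorem slope_add_le {a b : ℝ} {k l : ℕ} {x y : ℝ} (ha : 0 ≤ a) (hy : 0 ≤ y) (hxy : y ≤ x) :
    slope a b k l y + (k + l + 2) * a * ((l + 1) * y ^ l * (x - y)) ≤ slope a b k l x := by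
  have h := mul_le_mul_of_nonneg_left (mul_pow_mul_sub_le_pow_sub_pow l hy hxy)
    (show 0 ≤ (k + l + 2 : ℝ) * a by positivity)
  unfold slope
  linarith

theorem slope_mono {a b : ℝ} {k l : ℕ} {x y : ℝ} (ha : 0 ≤ a) (hy : 0 ≤ y) (hxy : y ≤ x) :
    slope a b k l y ≤ slope a b k l x := by
  have h : 0 ≤ (k + l + 2 : ℝ) * a * ((l + 1) * y ^ l * (x - y)) := by
    have := sub_nonneg.2 hxy
    positivity
  linarith [slope_add_le (b := b) (k := k) (l := l) ha hy hxy]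

section

variable {a b c : ℝ} {k l : ℕ} {lo hi : ℝ}

theorem MonoSide.mono {y : ℝ} (hs : MonoSide a b k l lo hi) (ha : 0 ≤ a) (hlo : 0 ≤ lo)
    (hy : lo ≤ y) : MonoSide a b k l y hi :=
  hs.imp (fun h => h.trans (slope_mono ha hlo hy)) id

/-- The quadratic lower bound coming from the leading term: `|f'(x)|` is compared with its value
for a trinomial whose critical point is the endpoint where `|f'|` is smallest. -/
theorem MonoSide.mul_sq_le_abs_tri_sub (hs : MonoSide a b k l lo hi) (ha : 1 ≤ a) (hlo : 0 < lo)
    (h : lo ≤ hi) :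
    (k + l + 2) * lo ^ (k + l) / 2 * (hi - lo) ^ 2 ≤ |tri a b c k l hi - tri a b c k l lo| := by
  have key : ∀ x z w s : ℝ, lo ≤ x → 0 ≤ w → lo ≤ z →
      (k + l + 2) * a * ((l + 1) * z ^ l * w) ≤ s →
      (k + l + 2) * lo ^ (k + l) * w ≤ x ^ k * s := by
    intro x z w s hx hw hz hs
    have h1 : lo ^ k ≤ x ^ k := pow_le_pow_left₀ hlo.le hx _
    have h2 : lo ^ l ≤ z ^ l := pow_le_pow_left₀ hlo.le hz _
    have hl : (1 : ℝ) ≤ l + 1 := by linarith [(Nat.cast_nonneg l : (0 : ℝ) ≤ l)]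
    calc (k + l + 2) * lo ^ (k + l) * w = lo ^ k * ((k + l + 2) * 1 * (1 * lo ^ l * w)) := by
          rw [pow_add]; ring
      _ ≤ x ^ k * ((k + l + 2) * a * ((l + 1) * z ^ l * w)) := by
          have := pow_nonneg (hlo.le.trans hx) k
          gcongr
      _ ≤ x ^ k * s := by
          have := pow_nonneg (hlo.le.trans hx) k
          gcongr
  refine half_mul_sq_le_abs_sub h (hasDerivAt_tri a b c k l) (hs.imp ?_ ?_)
  · intro hs x hx
    refine key x lo _ _ hx.1 (sub_nonneg.2 hx.1) le_rfl ?_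
    linarith [slope_add_le (b := b) (k := k) (l := l) (zero_le_one.trans ha) hlo.le hx.1]
  · intro hs x hx
    rw [← mul_neg]
    refine key x x _ _ hx.1 (sub_nonneg.2 hx.2) hx.1 ?_
    linarith [slope_add_le (b := b) (k := k) (l := l) (zero_le_one.trans ha)
      (hlo.le.trans hx.1) hx.2]

theorem MonoSide.abs_tri_sub_le {y : ℝ} (hs : MonoSide a b k l lo hi) (ha : 0 ≤ a) (hlo : 0 < lo)
    (hy : lo ≤ y) (hy' : y ≤ hi) :
    |tri a b c k l hi - tri a b c k l y| ≤ |tri a b c k l hi - tri a b c k l lo| := by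
  have hcont : ∀ s : Set ℝ, ContinuousOn (tri a b c k l) s := fun s x _ =>
    (hasDerivAt_tri a b c k l x).continuousAt.continuousWithinAt
  rcases hs with hs | hs
  · have hm : MonotoneOn (tri a b c k l) (Icc lo hi) := by
      refine monotoneOn_of_deriv_nonneg (convex_Icc lo hi) (hcont _)
        (fun x _ => (hasDerivAt_tri a b c k l x).differentiableAt.differentiableWithinAt)
        fun x hx => ?_
      have hx := interior_subset hx
      rw [(hasDerivAt_tri a b c k l x).deriv]
      exact mul_nonneg (pow_nonneg (hlo.le.trans hx.1) _)
        (hs.trans (slope_mono ha hlo.le hx.1))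
    have h1 := hm ⟨le_rfl, hy.trans hy'⟩ ⟨hy, hy'⟩ hy
    have h2 := hm ⟨hy, hy'⟩ ⟨hy.trans hy', le_rfl⟩ hy'
    rw [abs_of_nonneg, abs_of_nonneg] <;> linarith
  · have hm : AntitoneOn (tri a b c k l) (Icc lo hi) := by
      refine antitoneOn_of_deriv_nonpos (convex_Icc lo hi) (hcont _)
        (fun x _ => (hasDerivAt_tri a b c k l x).differentiableAt.differentiableWithinAt)
        fun x hx => ?_
      have hx := interior_subset hx
      rw [(hasDerivAt_tri a b c k l x).deriv]
      exact mul_nonpos_of_nonneg_of_nonpos (pow_nonneg (hlo.le.trans hx.1) _)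
        ((slope_mono ha (hlo.le.trans hx.1) hx.2).trans hs)
    have h1 := hm ⟨le_rfl, hy.trans hy'⟩ ⟨hy, hy'⟩ hy
    have h2 := hm ⟨hy, hy'⟩ ⟨hy.trans hy', le_rfl⟩ hy'
    rw [abs_of_nonpos, abs_of_nonpos] <;> linarith

/-- Passing from a point of `[lo, hi]` to `lo` costs a monomial at most a power of `lo / hi`. -/
theorem div_pow_mul_pow_le {α : ℝ} {i j : ℕ} (hij : i ≤ j) (hlo : 0 < lo) (hαlo : lo ≤ α)
    (hαhi : α ≤ hi) : (lo / hi) ^ j * α ^ i ≤ lo ^ i := by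
  have hα0 : 0 < α := hlo.trans_le hαlo
  have hhi : 0 < hi := hα0.trans_le hαhi
  have ht0 : 0 ≤ lo / hi := by positivity
  have ht1 : lo / hi ≤ 1 := (div_le_one hhi).2 (hαlo.trans hαhi)
  calc (lo / hi) ^ j * α ^ i ≤ (lo / hi) ^ i * hi ^ i := by
        gcongr ?_ * ?_
        · exact pow_le_pow_of_le_one ht0 ht1 hij
        · exact pow_le_pow_left₀ hα0.le hαhi _
    _ = lo ^ i := by rw [← mul_pow, div_mul_cancel₀ _ hhi.ne']

/-- For `b ≥ 0` the terms of `x f'(x)` do not cancel, and at the root their sum exceeds the height.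
This gives a constant lower bound for `x f'(x)`, which beats the linear one on short intervals. -/
theorem le_deriv_of_nonneg {α H x : ℝ} (ha : 0 < a) (hb : 0 ≤ b) (hlo : 0 < lo) (hα : 1 ≤ α)
    (hαlo : lo ≤ α) (hαhi : α ≤ hi) (root : tri a b c k l α = 0) (hH : H ≤ max a (max |b| |c|))
    (hclose : (k + l + 1) * (hi - lo) * hi ≤ lo ^ 2) (hx : x ∈ Icc lo hi) :
    (k + l + 1) * (H * (lo / hi) ^ (k + l + 2)) * (x - lo) ≤
      x ^ k * slope a b k l x * lo ^ 2 := by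
  have hx0 : 0 < x := hlo.trans_le hx.1
  have hα0 : 0 < α := hlo.trans_le hαlo
  have hhi : 0 < hi := hα0.trans_le hαhi
  have hw : 0 ≤ x - lo := sub_nonneg.2 hx.1
  have hA : a ≤ a * α ^ (k + l + 2) := le_mul_of_one_le_right ha.le (one_le_pow₀ hα)
  have hB : b ≤ b * α ^ (k + 1) := le_mul_of_one_le_right hb (one_le_pow₀ hα)
  unfold tri at root
  rw [abs_of_nonneg hb, abs_of_nonpos (by linarith : c ≤ 0)] at hH
  have hHc : H ≤ a * α ^ (k + l + 2) + b * α ^ (k + 1) := by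
    refine hH.trans (max_le ?_ (max_le ?_ ?_)) <;> linarith
  have hXc : H * (lo / hi) ^ (k + l + 2) ≤ a * lo ^ (k + l + 2) + b * lo ^ (k + 1) := by
    calc H * (lo / hi) ^ (k + l + 2)
        ≤ (a * α ^ (k + l + 2) + b * α ^ (k + 1)) * (lo / hi) ^ (k + l + 2) := by gcongr
      _ = a * ((lo / hi) ^ (k + l + 2) * α ^ (k + l + 2))
          + b * ((lo / hi) ^ (k + l + 2) * α ^ (k + 1)) := by ring
      _ ≤ _ := by
        gcongr
        · exact div_pow_mul_pow_le le_rfl hlo hαlo hαhi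
        · exact div_pow_mul_pow_le (by omega) hlo hαlo hαhi
  set X := H * (lo / hi) ^ (k + l + 2) with hX
  have h1 : a * lo ^ (k + l + 2) + b * lo ^ (k + 1) ≤ x * (x ^ k * slope a b k l x) := by
    have e : x * (x ^ k * slope a b k l x)
        = (k + l + 2) * (a * x ^ (k + l + 2)) + (k + 1) * (b * x ^ (k + 1)) := by
      unfold slope; ring
    rw [e]
    have p1 : a * lo ^ (k + l + 2) ≤ a * x ^ (k + l + 2) := by gcongr; exact hx.1
    have p2 : b * lo ^ (k + 1) ≤ b * x ^ (k + 1) := by gcongr; exact hx.1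
    have p3 : 0 ≤ (k + l + 1) * (a * x ^ (k + l + 2)) := by positivity
    have p4 : 0 ≤ k * (b * x ^ (k + 1)) := by positivity
    linarith
  set D := x ^ k * slope a b k l x with hD
  have h2 : (k + l + 1) * (x - lo) * x ≤ lo ^ 2 := by
    refine le_trans ?_ hclose
    have h7 := hx.2
    have h8 : 0 ≤ hi - lo := sub_nonneg.2 (hx.1.trans hx.2)
    gcongr
  have h3 : 0 ≤ x * D := le_trans (by positivity) h1
  have h4 : (k + l + 1) * X * (x - lo) * x ≤ (D * lo ^ 2) * x := by
    calc (k + l + 1) * X * (x - lo) * x = X * ((k + l + 1) * (x - lo) * x) := by ring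
      _ ≤ (x * D) * ((k + l + 1) * (x - lo) * x) :=
        mul_le_mul_of_nonneg_right (hXc.trans h1) (by positivity)
      _ ≤ (x * D) * lo ^ 2 := mul_le_mul_of_nonneg_left h2 h3
      _ = _ := by ring
  exact le_of_mul_le_mul_right h4 hx0

theorem add_add_one_le_mul (k l : ℕ) : (k + l + 1 : ℝ) ≤ (k + 1) * (l + 1) := by
  have : (0 : ℝ) ≤ k * l := by positivity
  linarith

/-- Increasing case with `b < 0`. At a root the larger of `a α ^ n` and `|b| α ^ (k + 1)` is at
least the height, and to the right of the critical point both are controlled by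
`(l + 1) n a lo ^ n`. -/
theorem le_deriv_of_neg {α H x : ℝ} (ha : 0 < a) (hb : b < 0) (hlo : 0 < lo) (hα : 1 ≤ α)
    (hαlo : lo ≤ α) (hαhi : α ≤ hi) (root : tri a b c k l α = 0) (hH : H ≤ max a (max |b| |c|))
    (hs : 0 ≤ slope a b k l lo) (hx : x ∈ Icc lo hi) :
    (k + l + 1) * (H * (lo / hi) ^ (k + l + 2)) * (x - lo) ≤
      x ^ k * slope a b k l x * lo ^ 2 := by
  have hα0 : 0 < α := hlo.trans_le hαlo
  have hhi : 0 < hi := hα0.trans_le hαhi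
  have hx0 : 0 < x := hlo.trans_le hx.1
  have hb' : 0 < -b := by linarith
  have hw : 0 ≤ x - lo := sub_nonneg.2 hx.1
  have hA : a ≤ a * α ^ (k + l + 2) := le_mul_of_one_le_right ha.le (one_le_pow₀ hα)
  have hB : -b ≤ -b * α ^ (k + 1) := le_mul_of_one_le_right hb'.le (one_le_pow₀ hα)
  have hA0 : 0 ≤ a * α ^ (k + l + 2) := by positivity
  have hB0 : 0 ≤ -b * α ^ (k + 1) := by positivity
  unfold tri at root
  rw [abs_of_neg hb] at hH
  have hZA : (k + l + 1) * (a * lo ^ (k + l + 2)) ≤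
      (l + 1) * (k + l + 2) * (a * lo ^ (k + l + 2)) := by
    have : (0 : ℝ) ≤ l * (k + l + 2) := by positivity
    gcongr
    linarith
  have hZB : (k + l + 1) * (-b * lo ^ (k + 1)) ≤
      (l + 1) * (k + l + 2) * (a * lo ^ (k + l + 2)) := by
    calc (k + l + 1) * (-b * lo ^ (k + 1)) ≤ (k + 1) * (l + 1) * (-b * lo ^ (k + 1)) :=
          mul_le_mul_of_nonneg_right (add_add_one_le_mul k l) (by positivity)
      _ ≤ (k + 1) * (l + 1) * (-b * lo ^ (k + 1))
          + (l + 1) * lo ^ (k + 1) * slope a b k l lo := by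
          have : 0 ≤ (l + 1) * lo ^ (k + 1) * slope a b k l lo := by positivity
          linarith
      _ = _ := by unfold slope; ring
  -- a monomial dominating the height at the root still does so at `lo`, up to `(lo / hi) ^ n`
  have hlow : ∀ e i, i ≤ k + l + 2 → 0 ≤ e → H ≤ e * α ^ i →
      H * (lo / hi) ^ (k + l + 2) ≤ e * lo ^ i := fun e i hi' he hh => by
    calc H * (lo / hi) ^ (k + l + 2) ≤ e * α ^ i * (lo / hi) ^ (k + l + 2) := by gcongr
      _ = e * ((lo / hi) ^ (k + l + 2) * α ^ i) := by ring
      _ ≤ _ := by gcongr; exact div_pow_mul_pow_le hi' hlo hαlo hαhi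
  have hZ : (k + l + 1) * (H * (lo / hi) ^ (k + l + 2)) ≤
      (l + 1) * (k + l + 2) * (a * lo ^ (k + l + 2)) := by
    rcases le_total (a * α ^ (k + l + 2)) (-b * α ^ (k + 1)) with hh | hh
    · refine le_trans ?_ hZB
      refine mul_le_mul_of_nonneg_left ?_ (by positivity)
      refine hlow _ _ (by omega) hb'.le (hH.trans (max_le ?_ (max_le ?_ ?_)))
      · linarith
      · exact hB
      · rw [abs_le]; constructor <;> linarith
    · refine le_trans ?_ hZA
      refine mul_le_mul_of_nonneg_left ?_ (by positivity)
      refine hlow _ _ le_rfl ha.le (hH.trans (max_le ?_ (max_le ?_ ?_)))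
      · exact hA
      · linarith
      · rw [abs_le]; constructor <;> linarith
  have h5 := slope_add_le (b := b) (k := k) (l := l) ha.le hlo.le hx.1
  have h6 : lo ^ k ≤ x ^ k := pow_le_pow_left₀ hlo.le hx.1 _
  calc (k + l + 1) * (H * (lo / hi) ^ (k + l + 2)) * (x - lo)
      ≤ (l + 1) * (k + l + 2) * (a * lo ^ (k + l + 2)) * (x - lo) :=
        mul_le_mul_of_nonneg_right hZ hw
    _ = lo ^ k * ((k + l + 2) * a * ((l + 1) * lo ^ l * (x - lo))) * lo ^ 2 := by ring
    _ ≤ x ^ k * slope a b k l x * lo ^ 2 := by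
      gcongr
      linarith

/-- Decreasing case. To the left of the critical point the middle term dominates, so it exceeds the
height at the root. -/
theorem le_neg_deriv {α H x : ℝ} (ha : 0 < a) (hlo : 0 < lo) (hα : 1 ≤ α)
    (hαlo : lo ≤ α) (hαhi : α ≤ hi) (root : tri a b c k l α = 0) (hH : H ≤ max a (max |b| |c|))
    (hs : slope a b k l hi ≤ 0) (hx : x ∈ Icc lo hi) :
    (k + l + 1) * (H * (lo / hi) ^ (k + l + 2)) * (hi - x) ≤
      -(x ^ k * slope a b k l x) * lo ^ 2 := by
  have hα0 : 0 < α := hlo.trans_le hαlo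
  have hhi : 0 < hi := hα0.trans_le hαhi
  have hx0 : 0 < x := hlo.trans_le hx.1
  have hw : 0 ≤ hi - x := sub_nonneg.2 hx.2
  have hb' : 0 < -b := by
    by_contra hb
    have : 0 < slope a b k l hi := by
      unfold slope
      have : 0 ≤ b := by linarith
      positivity
    linarith
  have hA : a ≤ a * α ^ (k + l + 2) := le_mul_of_one_le_right ha.le (one_le_pow₀ hα)
  have hB : -b ≤ -b * α ^ (k + 1) := le_mul_of_one_le_right hb'.le (one_le_pow₀ hα)
  have hA0 : 0 ≤ a * α ^ (k + l + 2) := by positivity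
  rw [abs_of_neg (by linarith : b < 0)] at hH
  have hAB : a * α ^ (k + l + 2) ≤ -b * α ^ (k + 1) := by
    have h1 : slope a b k l α ≤ 0 := (slope_mono ha.le hα0.le hαhi).trans hs
    have h2 : α ^ (k + 1) * slope a b k l α ≤ 0 :=
      mul_nonpos_of_nonneg_of_nonpos (by positivity) h1
    have e : α ^ (k + 1) * slope a b k l α
        = (k + l + 2) * (a * α ^ (k + l + 2)) - (k + 1) * (-b * α ^ (k + 1)) := by
      unfold slope; ring
    have h3 : (k + 1) * (a * α ^ (k + l + 2)) ≤ (k + l + 2) * (a * α ^ (k + l + 2)) := by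
      refine mul_le_mul_of_nonneg_right ?_ hA0
      linarith [(Nat.cast_nonneg l : (0 : ℝ) ≤ l)]
    exact le_of_mul_le_mul_left (by linarith : (k + 1) * (a * α ^ (k + l + 2)) ≤
      (k + 1) * (-b * α ^ (k + 1))) (by positivity)
  unfold tri at root
  have hHB : H ≤ -b * α ^ (k + 1) := by
    refine hH.trans (max_le ?_ (max_le ?_ ?_))
    · linarith
    · exact hB
    · rw [abs_le]; constructor <;> linarith
  have hXs : H * (lo / hi) ^ (k + l + 2) ≤ -b * lo ^ (k + 1) * (lo / hi) ^ (l + 1) := by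
    calc H * (lo / hi) ^ (k + l + 2)
        ≤ -b * α ^ (k + 1) * (lo / hi) ^ (k + l + 2) := by gcongr
      _ = -b * ((lo / hi) ^ (k + 1) * α ^ (k + 1)) * (lo / hi) ^ (l + 1) := by ring
      _ ≤ _ := by gcongr; exact div_pow_mul_pow_le le_rfl hlo hαlo hαhi
  -- compare with the slope that vanishes exactly at `hi`
  have h1 : (k + 1) * -b * (hi ^ (l + 1) - x ^ (l + 1)) ≤ -slope a b k l x * hi ^ (l + 1) := by
    have h2 : 0 ≤ -slope a b k l hi * x ^ (l + 1) :=
      mul_nonneg (by linarith) (by positivity)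
    have e : -slope a b k l x * hi ^ (l + 1) = (k + 1) * -b * (hi ^ (l + 1) - x ^ (l + 1))
        + -slope a b k l hi * x ^ (l + 1) := by unfold slope; ring
    linarith
  have h3 := mul_pow_mul_sub_le_pow_sub_pow l hx0.le hx.2
  have h4 : lo ^ k ≤ x ^ k := pow_le_pow_left₀ hlo.le hx.1 _
  have h5 : lo ^ l ≤ x ^ l := pow_le_pow_left₀ hlo.le hx.1 _
  have h6 : (k + l + 1) * (H * (lo / hi) ^ (k + l + 2)) * (hi - x) * hi ^ (l + 1) ≤
      -(x ^ k * slope a b k l x) * lo ^ 2 * hi ^ (l + 1) := by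
    calc (k + l + 1) * (H * (lo / hi) ^ (k + l + 2)) * (hi - x) * hi ^ (l + 1)
        ≤ (k + l + 1) * (-b * lo ^ (k + 1) * (lo / hi) ^ (l + 1)) * (hi - x)
          * hi ^ (l + 1) := by gcongr
      _ ≤ (k + 1) * (l + 1) * (-b * lo ^ (k + 1) * (lo / hi) ^ (l + 1)) * (hi - x)
          * hi ^ (l + 1) := by
        gcongr ?_ * _ * _ * _
        exact add_add_one_le_mul k l
      _ = lo ^ k * ((k + 1) * -b * ((l + 1) * lo ^ l * (hi - x))) * lo ^ 2 := by
        rw [div_pow]; field_simp; ring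
      _ ≤ x ^ k * ((k + 1) * -b * ((l + 1) * x ^ l * (hi - x))) * lo ^ 2 := by gcongr
      _ ≤ x ^ k * ((k + 1) * -b * (hi ^ (l + 1) - x ^ (l + 1))) * lo ^ 2 := by gcongr
      _ ≤ x ^ k * (-slope a b k l x * hi ^ (l + 1)) * lo ^ 2 := by gcongr
      _ = _ := by ring
  exact le_of_mul_le_mul_right h6 (by positivity)

/-- The quadratic lower bound with the height as coefficient, on a short interval containing a root
`α ≥ 1`. -/
theorem MonoSide.height_mul_sq_le_abs_tri_sub {α H : ℝ} (hs : MonoSide a b k l lo hi)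
    (ha : 0 < a) (hlo : 0 < lo) (hα : 1 ≤ α) (hαlo : lo ≤ α) (hαhi : α ≤ hi)
    (root : tri a b c k l α = 0) (hH : H ≤ max a (max |b| |c|))
    (hclose : (k + l + 1) * (hi - lo) * hi ≤ lo ^ 2) :
    (k + l + 1) * H * (lo / hi) ^ (k + l + 2) / 2 * ((hi - lo) / lo) ^ 2 ≤
      |tri a b c k l hi - tri a b c k l lo| := by
  have hrw : (k + l + 1) * H * (lo / hi) ^ (k + l + 2) / 2 * ((hi - lo) / lo) ^ 2
      = ((k + l + 1) * (H * (lo / hi) ^ (k + l + 2)) / lo ^ 2) / 2 * (hi - lo) ^ 2 := by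
    generalize (lo / hi) ^ (k + l + 2) = t
    field_simp
  rw [hrw]
  refine half_mul_sq_le_abs_sub (hαlo.trans hαhi) (hasDerivAt_tri a b c k l)
    (hs.imp (fun hs x hx => ?_) fun hs x hx => ?_)
  all_goals rw [div_mul_eq_mul_div, div_le_iff₀ (by positivity)]
  · rcases le_or_gt 0 b with hb | hb
    · exact le_deriv_of_nonneg ha hb hlo hα hαlo hαhi root hH hclose hx
    · exact le_deriv_of_neg ha hb hlo hα hαlo hαhi root hH hs hx
  · exact le_neg_deriv ha hlo hα hαlo hαhi root hH hs hx

/-! ### The distance from a root to a point where the trinomial is small -/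

theorem mul_le_half_of_sq_mul_le {N s : ℝ} (hN : 6 ≤ N)
    (h : (N * s) ^ 2 * ((N - 1) * (N - 2)) ≤ 4) : N * s ≤ 1 / 2 := by
  have h1 : (20 : ℝ) ≤ (N - 1) * (N - 2) := by nlinarith
  have h2 : (N * s) ^ 2 * 20 ≤ 4 := (mul_le_mul_of_nonneg_left h1 (sq_nonneg _)).trans h
  by_contra hc
  nlinarith

/-- Bernoulli's inequality, applied to the relative distance `s` allowed by `sq_sub_root_le`. -/
theorem lt_one_sub_pow (hN : 4 ≤ k + l) {s : ℝ} (hs : 0 ≤ s)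
    (h : ((k + l + 2) * s) ^ 2 * (((k + l + 2 : ℝ) - 1) * ((k + l + 2 : ℝ) - 2)) ≤ 4) :
    ((k + l + 2 : ℝ) - 1) * ((k + l + 2 : ℝ) - 2) / (k + l + 2) ^ 2 < (1 - s) ^ (k + l) := by
  have hN' : (4 : ℝ) ≤ k + l := by exact_mod_cast hN
  have hhalf := mul_le_half_of_sq_mul_le (by linarith) h
  have hber := one_add_mul_le_pow (show (-2 : ℝ) ≤ -s by nlinarith) (k + l)
  push_cast at hber
  rw [← sub_eq_add_neg] at hber
  refine lt_of_lt_of_le ?_ hber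
  generalize hM : (k + l : ℝ) = M at *
  have h2 : M * (M + 2) * s < 2 := by
    by_contra hc
    have h3 : (2 : ℝ) ^ 2 ≤ (M * (M + 2) * s) ^ 2 := pow_le_pow_left₀ (by norm_num) (not_lt.1 hc) 2
    have h4 : (M * (M + 2) * s) ^ 2 * (M + 1) ≤ 4 * M := by
      calc (M * (M + 2) * s) ^ 2 * (M + 1)
          = M * (((M + 2) * s) ^ 2 * ((M + 2 - 1) * (M + 2 - 2))) := by ring
        _ ≤ M * 4 := mul_le_mul_of_nonneg_left h (by linarith)
        _ = _ := by ring
    nlinarith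
  rw [div_lt_iff₀ (by positivity)]
  nlinarith

/-- If `|f(ρ)| ≤ ε ρ ^ n` with `ε` small and no critical point separates `ρ` from the root `α`, then
`(ρ - α) ^ 2 ≤ 2 n / ((n - 1) (n - 2)) * ε * ρ ^ 2`. To the left of the root the quadratic bound
gives the better constant `2 / n`; to the right a little is lost, because the bound involves the
left endpoint of the interval. -/
theorem sq_sub_root_le {α ρ ε : ℝ} (hN : 4 ≤ k + l) (ha : 1 ≤ a) (hα : 0 < α) (hρ : 0 < ρ)
    (hs : MonoSide a b k l (min α ρ) (max α ρ)) (root : tri a b c k l α = 0) (hε : 0 < ε)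
    (hεN : (k + l + 2) ^ 3 * ε ≤ 2) (hval : |tri a b c k l ρ| ≤ ρ ^ (k + l + 2) * ε) :
    (ρ - α) ^ 2 ≤ 2 * (k + l + 2) / (((k + l + 2 : ℝ) - 1) * ((k + l + 2 : ℝ) - 2)) * ε * ρ ^ 2 := by
  have hN' : (4 : ℝ) ≤ k + l := by exact_mod_cast hN
  have hM0 : 0 < ((k + l + 2 : ℝ) - 1) * ((k + l + 2 : ℝ) - 2) :=
    mul_pos (by linarith) (by linarith)
  rcases le_or_gt ρ α with h | h
  · rw [min_eq_right h, max_eq_left h] at hs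
    have h1 := hs.mul_sq_le_abs_tri_sub (c := c) ha hρ h
    rw [root, zero_sub, abs_neg] at h1
    have h2 : ρ ^ (k + l) * ((k + l + 2) / 2 * (α - ρ) ^ 2) ≤ ρ ^ (k + l) * (ρ ^ 2 * ε) := by
      calc _ = (k + l + 2) * ρ ^ (k + l) / 2 * (α - ρ) ^ 2 := by ring
        _ ≤ _ := h1
        _ ≤ _ := hval
        _ = _ := by ring
    have h3 := le_of_mul_le_mul_left h2 (by positivity)
    have h4 : 2 / (k + l + 2 : ℝ) ≤
        2 * (k + l + 2) / (((k + l + 2 : ℝ) - 1) * ((k + l + 2 : ℝ) - 2)) := by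
      rw [div_le_div_iff₀ (by positivity) hM0]
      nlinarith
    calc (ρ - α) ^ 2 = 2 / (k + l + 2) * ((k + l + 2) / 2 * (α - ρ) ^ 2) := by
          field_simp; ring
      _ ≤ 2 / (k + l + 2) * (ρ ^ 2 * ε) := by gcongr
      _ ≤ _ := by
        rw [mul_assoc _ ε, mul_comm ε]
        exact mul_le_mul_of_nonneg_right h4 (by positivity)
  · rw [min_eq_left h.le, max_eq_right h.le] at hs
    set M := 2 * (k + l + 2) / (((k + l + 2 : ℝ) - 1) * ((k + l + 2 : ℝ) - 2)) with hM
    have hMpos : 0 < M := by positivity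
    obtain ⟨s, hs0, hs2⟩ : ∃ s : ℝ, 0 < s ∧ s ^ 2 = M * ε :=
      ⟨√(M * ε), Real.sqrt_pos.2 (by positivity), Real.sq_sqrt (by positivity)⟩
    have hsM : s ^ 2 * (((k + l + 2 : ℝ) - 1) * ((k + l + 2 : ℝ) - 2)) = 2 * (k + l + 2) * ε := by
      rw [hs2, hM, mul_right_comm, div_mul_cancel₀ _ hM0.ne']
    have h4 : ((k + l + 2) * s) ^ 2 * (((k + l + 2 : ℝ) - 1) * ((k + l + 2 : ℝ) - 2)) ≤ 4 := by
      rw [mul_pow, mul_assoc, hsM]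
      linarith
    have hhalf := mul_le_half_of_sq_mul_le (by linarith) h4
    have hpow := lt_one_sub_pow hN hs0.le h4
    have hs1 : 0 < 1 - s := by nlinarith
    by_contra! hc
    have hlt : s * ρ < ρ - α := by
      refine lt_of_pow_lt_pow_left₀ 2 (by linarith) ?_
      rw [mul_pow, hs2]
      exact hc
    -- `f` is monotone on `[α, ρ]`, so the value at `ρ` bounds the increment over `[ρ (1 - s), ρ]`
    have hy : α ≤ ρ * (1 - s) := by linarith
    have hy' : ρ * (1 - s) ≤ ρ := by nlinarith
    have h5 := hs.abs_tri_sub_le (c := c) (zero_le_one.trans ha) hα hy hy'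
    have h6 := (hs.mono (zero_le_one.trans ha) hα.le hy).mul_sq_le_abs_tri_sub (c := c) ha
      (by positivity) hy'
    rw [root, sub_zero] at h5
    have h7 := (h6.trans h5).trans hval
    have h8 : ρ ^ (k + l + 2) * ((k + l + 2) / 2 * (1 - s) ^ (k + l) * s ^ 2) ≤
        ρ ^ (k + l + 2) * ε := by
      refine le_trans (le_of_eq ?_) h7
      rw [mul_pow]
      ring
    have h9 := le_of_mul_le_mul_left h8 (by positivity)
    rw [div_lt_iff₀ (by positivity)] at hpow
    have h10 : ((k + l + 2 : ℝ) - 1) * ((k + l + 2 : ℝ) - 2) * (s ^ 2 / (2 * (k + l + 2))) <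
        (1 - s) ^ (k + l) * (k + l + 2) ^ 2 * (s ^ 2 / (2 * (k + l + 2))) :=
      mul_lt_mul_of_pos_right hpow (by positivity)
    have e1 : ((k + l + 2 : ℝ) - 1) * ((k + l + 2 : ℝ) - 2) * (s ^ 2 / (2 * (k + l + 2))) = ε := by
      rw [← mul_div_assoc, mul_comm, hsM]
      field_simp
    have e2 : (1 - s) ^ (k + l) * (k + l + 2) ^ 2 * (s ^ 2 / (2 * (k + l + 2)))
        = (k + l + 2) / 2 * (1 - s) ^ (k + l) * s ^ 2 := by
      field_simp
    linarith

/-- The distance estimate involving the height, for points already known to be close to the root. -/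
theorem height_mul_sq_sub_root_le {α ρ H s : ℝ} (hN : 4 ≤ k + l) (ha : 0 < a) (hα : 1 ≤ α)
    (hρ : 0 < ρ) (hs : MonoSide a b k l (min α ρ) (max α ρ)) (root : tri a b c k l α = 0)
    (hH0 : 0 ≤ H) (hH : H ≤ max a (max |b| |c|)) (hs0 : 0 ≤ s) (hsN : (k + l + 2) * s ≤ 1 / 2)
    (hclose : |ρ - α| ≤ s * ρ) :
    (k + l + 1) / 4 * H * (ρ - α) ^ 2 ≤ |tri a b c k l ρ| * ρ ^ 2 := by
  have hN' : (4 : ℝ) ≤ k + l := by exact_mod_cast hN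
  have hα0 : 0 < α := by linarith
  obtain ⟨lo, hlo⟩ : ∃ lo, lo = min α ρ := ⟨_, rfl⟩
  obtain ⟨hi, hhi⟩ : ∃ hi, hi = max α ρ := ⟨_, rfl⟩
  rw [← hlo, ← hhi] at hs
  have hlo0 : 0 < lo := hlo ▸ lt_min hα0 hρ
  have hαlo : lo ≤ α := hlo ▸ min_le_left _ _
  have hρlo : lo ≤ ρ := hlo ▸ min_le_right _ _
  have hαhi : α ≤ hi := hhi ▸ le_max_left _ _
  have hρhi : ρ ≤ hi := hhi ▸ le_max_right _ _
  have hhi0 : 0 < hi := hlo0.trans_le (hαlo.trans hαhi)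
  have habs : hi - lo = |ρ - α| := by rw [hlo, hhi, max_sub_min_eq_abs]
  have hsub : hi - lo ≤ s * hi := by
    rw [habs]
    exact hclose.trans (by gcongr)
  have hs1 : s ≤ 1 / 12 := by nlinarith
  have hval : |tri a b c k l hi - tri a b c k l lo| = |tri a b c k l ρ| := by
    rcases le_total α ρ with h | h
    · rw [hlo, hhi, min_eq_left h, max_eq_right h, root, sub_zero]
    · rw [hlo, hhi, min_eq_right h, max_eq_left h, root, zero_sub, abs_neg]
  have hcl : (k + l + 1) * (hi - lo) * hi ≤ lo ^ 2 := by
    have h1 : (1 - s) * hi ≤ lo := by linarith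
    calc (k + l + 1) * (hi - lo) * hi ≤ (k + l + 1) * (s * hi) * hi := by gcongr
      _ = ((k + l + 1) * s) * hi ^ 2 := by ring
      _ ≤ (1 - s) ^ 2 * hi ^ 2 := by
        gcongr
        nlinarith
      _ = ((1 - s) * hi) ^ 2 := by ring
      _ ≤ lo ^ 2 := pow_le_pow_left₀ (mul_nonneg (by linarith) hhi0.le) h1 2
  have h2 := hs.height_mul_sq_le_abs_tri_sub ha hlo0 hα hαlo hαhi root hH hcl
  rw [hval] at h2
  have ht : 1 - s ≤ lo / hi := by
    rw [le_div_iff₀ hhi0]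
    linarith
  -- Bernoulli's inequality bounds the loss in the `n`-th power by a factor `2`
  have htn : 1 / 2 ≤ (lo / hi) ^ (k + l + 2) := by
    have hber := one_add_mul_le_pow (show (-2 : ℝ) ≤ -s by linarith) (k + l + 2)
    push_cast at hber
    rw [← sub_eq_add_neg] at hber
    refine le_trans ?_ (hber.trans (pow_le_pow_left₀ (by linarith) ht _))
    linarith
  have hδ : (ρ - α) ^ 2 / ρ ^ 2 ≤ ((hi - lo) / lo) ^ 2 := by
    rw [div_pow, habs, sq_abs]
    gcongr
  calc (k + l + 1) / 4 * H * (ρ - α) ^ 2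
      = (k + l + 1) * H * (1 / 2) / 2 * ((ρ - α) ^ 2 / ρ ^ 2) * ρ ^ 2 := by field_simp; ring
    _ ≤ (k + l + 1) * H * (lo / hi) ^ (k + l + 2) / 2 * ((hi - lo) / lo) ^ 2 * ρ ^ 2 := by gcongr
    _ ≤ _ := by gcongr

/-! ### The interval belonging to a root -/

theorem slope_strictMono {x y : ℝ} (ha : 0 < a) (hy : 0 ≤ y) (hxy : y < x) :
    slope a b k l y < slope a b k l x := by
  have h : y ^ (l + 1) < x ^ (l + 1) := pow_lt_pow_left₀ hxy hy (by omega)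
  have := mul_lt_mul_of_pos_left h (show 0 < (k + l + 2 : ℝ) * a by positivity)
  unfold slope
  linarith

theorem tri_lt_tri_of_slope_nonneg {x y : ℝ} (ha : 0 < a) (hx : 0 ≤ x) (hxy : x < y)
    (hs : 0 ≤ slope a b k l x) : tri a b c k l x < tri a b c k l y := by
  refine strictMonoOn_of_deriv_pos (convex_Icc x y)
    (fun z _ => (hasDerivAt_tri a b c k l z).continuousAt.continuousWithinAt) (fun z hz => ?_)
    (left_mem_Icc.2 hxy.le) (right_mem_Icc.2 hxy.le) hxy
  rw [interior_Icc] at hz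
  rw [(hasDerivAt_tri a b c k l z).deriv]
  exact mul_pos (pow_pos (hx.trans_lt hz.1) _) (hs.trans_lt (slope_strictMono ha hx hz.1))

theorem tri_lt_tri_of_slope_nonpos {x y : ℝ} (ha : 0 < a) (hx : 0 ≤ x) (hxy : x < y)
    (hs : slope a b k l y ≤ 0) : tri a b c k l y < tri a b c k l x := by
  refine strictAntiOn_of_deriv_neg (convex_Icc x y)
    (fun z _ => (hasDerivAt_tri a b c k l z).continuousAt.continuousWithinAt) (fun z hz => ?_)
    (left_mem_Icc.2 hxy.le) (right_mem_Icc.2 hxy.le) hxy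
  rw [interior_Icc] at hz
  rw [(hasDerivAt_tri a b c k l z).deriv]
  have hz0 : 0 < z := hx.trans_lt hz.1
  exact mul_neg_of_pos_of_neg (pow_pos hz0 _)
    ((slope_strictMono ha hz0.le hz.2).trans_le hs)

theorem continuous_tri : Continuous (tri a b c k l) := by
  unfold tri
  fun_prop

theorem continuous_slope : Continuous (slope a b k l) := by
  unfold slope
  fun_prop

/-- The trinomial takes positive values arbitrarily far to the right. -/
theorem exists_tri_pos (ha : 1 ≤ a) (x₀ : ℝ) : ∃ x, x₀ < x ∧ 0 < tri a b c k l x := by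
  refine ⟨|x₀| + |b| + |c| + 1, ?_, ?_⟩
  · linarith [le_abs_self x₀, abs_nonneg b, abs_nonneg c]
  · set x := |x₀| + |b| + |c| + 1 with hx
    have hx1 : 1 ≤ x := by linarith [abs_nonneg x₀, abs_nonneg b, abs_nonneg c]
    have h1 : x ≤ a * x ^ (l + 1) := by
      calc x = 1 * x ^ 1 := by ring
        _ ≤ a * x ^ (l + 1) :=
          mul_le_mul ha (pow_le_pow_right₀ hx1 (by omega)) (by positivity) (by linarith)
    have h2 : |c| + 1 ≤ a * x ^ (l + 1) + b := by
      linarith [neg_abs_le b, abs_nonneg x₀]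
    have h3 : |c| + 1 ≤ x ^ (k + 1) * (a * x ^ (l + 1) + b) :=
      h2.trans (le_mul_of_one_le_left (by linarith [abs_nonneg c]) (one_le_pow₀ hx1))
    have e : tri a b c k l x = x ^ (k + 1) * (a * x ^ (l + 1) + b) + c := by
      unfold tri; ring
    rw [e]
    linarith [neg_abs_le c]

/-- A root to the right of `τ i` forces the right end of the interval belonging to `τ i` to be a
critical point, again to the right of `τ i`. -/
theorem IsExceptionalPartition.exists_right {g : ℝ[X]} {N : ℕ} {τ : Fin N → ℝ}
    {η : Fin (N + 1) → EReal} (part : IsExceptionalPartition g τ η) {i : Fin N} {β : ℝ}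
    (hβ : g.eval β = 0) (hlt : τ i < β) :
    ∃ e : ℝ, η i.succ = e ∧ IsCriticalPoint g e ∧ τ i < e := by
  have hmem : β ∈ Set.range τ := by
    rw [part.range_eq]
    exact Or.inl hβ
  obtain ⟨j, rfl⟩ := hmem
  have hij : i < j := part.strictMono.lt_iff_lt.1 hlt
  have hi : (i : ℕ) + 1 < N := by have := j.2; omega
  obtain ⟨e, he, himp, h1, -⟩ := part.separates i hi
  exact ⟨e, he, himp.1, h1⟩

/-- A root to the left of `τ i` forces the left end of the interval belonging to `τ i` to be a
critical point beyond that root. -/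
theorem IsExceptionalPartition.exists_left {g : ℝ[X]} {N : ℕ} {τ : Fin N → ℝ}
    {η : Fin (N + 1) → EReal} (part : IsExceptionalPartition g τ η) {i : Fin N} {β : ℝ}
    (hβ : g.eval β = 0) (hlt : β < τ i) :
    ∃ e : ℝ, η i.castSucc = e ∧ IsCriticalPoint g e ∧ β < e := by
  have hmem : β ∈ Set.range τ := by
    rw [part.range_eq]
    exact Or.inl hβ
  obtain ⟨j, rfl⟩ := hmem
  have hij : j < i := part.strictMono.lt_iff_lt.1 hlt
  obtain ⟨i', hi'⟩ : ∃ i', (i : ℕ) = i' + 1 := ⟨i - 1, by omega⟩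
  have hi : i' + 1 < N := hi' ▸ i.2
  obtain ⟨e, he, himp, h1, -⟩ := part.separates i' hi
  refine ⟨e, ?_, himp.1, lt_of_le_of_lt (part.strictMono.monotone ?_) h1⟩
  · rw [← he]
    congr 1
    ext
    simp [hi']
  · rw [Fin.le_def]
    simp only
    omega

/-- No critical point separates a positive root `τ i` from a positive `ρ` that belongs to it and
satisfies `|f(ρ)| ≤ 1`. If the critical point `x₀` did separate them, then `f(x₀) < 0`. When
`τ i < ρ` there is a further root beyond `x₀`; when `ρ < τ i` there is one in `(0, x₀)` if `c > 0`.
In both cases the separator towards that root is a positive critical point, hence `x₀`, and cuts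
`ρ` off. When `ρ < τ i` and `c ≤ 0`, the trinomial decreases from `c ≤ -1` on `[0, ρ]`, so that
`|f(ρ)| > 1`. The factor `σ` is the sign that makes the leading coefficient positive. -/
theorem monoSide_of_belongsTo {g : ℝ[X]} {N : ℕ} {τ : Fin N → ℝ}
    {η : Fin (N + 1) → EReal} (part : IsExceptionalPartition g τ η) {i : Fin N} {σ ρ : ℝ}
    (hσ : σ ≠ 0) (hg : ∀ x, tri a b c k l x = σ * g.eval x) (ha : 1 ≤ a) (hc : 1 ≤ |c|)
    (hα : 0 < τ i) (root : tri a b c k l (τ i) = 0) (hρ : 0 < ρ) (hval : |tri a b c k l ρ| ≤ 1)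
    (hbel : BelongsTo η i ρ) : MonoSide a b k l (min (τ i) ρ) (max (τ i) ρ) := by
  have ha0 : 0 < a := by linarith
  have hroot : ∀ x, tri a b c k l x = 0 → g.eval x = 0 := fun x hx => by
    rw [hg] at hx
    exact (mul_eq_zero.1 hx).resolve_left hσ
  have hcrit : ∀ e, 0 < e → IsCriticalPoint g e → slope a b k l e = 0 := fun e he hcr => by
    have h1 : HasDerivAt (tri a b c k l) (σ * (derivative g).eval e) e := by
      have := (g.hasDerivAt e).const_mul σ
      exact this.congr_of_eventuallyEq (Filter.Eventually.of_forall hg)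
    have h2 := (hasDerivAt_tri a b c k l e).unique h1
    rw [show (derivative g).eval e = 0 from hcr, mul_zero] at h2
    exact (mul_eq_zero.1 h2).resolve_left (pow_pos he _).ne'
  by_contra hns
  rw [MonoSide, not_or, not_le, not_le] at hns
  rcases le_or_gt (τ i) ρ with h | h
  · rw [min_eq_left h, max_eq_right h] at hns
    obtain ⟨x₀, hx₀, hsx⟩ := intermediate_value_Icc h continuous_slope.continuousOn
      ⟨hns.1.le, hns.2.le⟩
    have hlt : τ i < x₀ := lt_of_le_of_ne hx₀.1 fun hh => by
      rw [← hh] at hsx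
      linarith [hns.1]
    have hneg := tri_lt_tri_of_slope_nonpos (c := c) ha0 hα.le hlt hsx.le
    rw [root] at hneg
    obtain ⟨x₁, hx₁, hpos⟩ := exists_tri_pos (b := b) (c := c) (k := k) (l := l) ha x₀
    obtain ⟨β, hβ, hβ0⟩ := intermediate_value_Icc hx₁.le
      (continuous_tri (a := a) (b := b) (c := c) (k := k) (l := l)).continuousOn ⟨hneg.le, hpos.le⟩
    obtain ⟨e, he, hcr, hie⟩ := part.exists_right (hroot β hβ0) (hlt.trans_le hβ.1)
    have h2 := hbel.2
    rw [he, EReal.coe_lt_coe_iff] at h2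
    linarith [hcrit e (hα.trans hie) hcr, hns.2,
      slope_mono (b := b) (k := k) (l := l) ha0.le hρ.le h2.le]
  · rw [min_eq_right h.le, max_eq_left h.le] at hns
    rcases le_or_gt c 0 with hc0 | hc0
    · rw [abs_of_nonpos hc0] at hc
      have h1 := tri_lt_tri_of_slope_nonpos (c := c) ha0 le_rfl hρ hns.1.le
      have h2 : tri a b c k l 0 = c := by simp [tri]
      linarith [(abs_le.1 hval).1]
    · obtain ⟨x₀, hx₀, hsx⟩ := intermediate_value_Icc h.le continuous_slope.continuousOn
        ⟨hns.1.le, hns.2.le⟩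
      have hlt : x₀ < τ i := lt_of_le_of_ne hx₀.2 fun hh => by
        rw [hh] at hsx
        linarith [hns.2]
      have hx₀' : 0 < x₀ := hρ.trans_le hx₀.1
      have hneg := tri_lt_tri_of_slope_nonneg (c := c) ha0 hx₀'.le hlt hsx.ge
      rw [root] at hneg
      have h2 : tri a b c k l 0 = c := by simp [tri]
      obtain ⟨β, hβ, hβ0⟩ := intermediate_value_Icc' hx₀'.le
        (continuous_tri (a := a) (b := b) (c := c) (k := k) (l := l)).continuousOn
        ⟨hneg.le, by rw [h2]; exact hc0.le⟩
      obtain ⟨e, he, hcr, hie⟩ := part.exists_left (hroot β hβ0) (hβ.2.trans_lt hlt)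
      have he0 : 0 < e := hβ.1.trans_lt hie
      have h3 := hbel.1
      rw [he, EReal.coe_le_coe_iff] at h3
      linarith [hcrit e he0 hcr, hns.1,
        slope_mono (b := b) (k := k) (l := l) ha0.le he0.le h3]

/-! ### Interpolation between the two distance estimates -/

theorem cube_le_two_mul_p₀_pow {n : ℕ} (hn : 6 ≤ n) : n ^ 3 ≤ 2 * p₀ n ^ n := by
  rcases le_or_gt n 8 with h | h
  · rw [p₀, if_pos h]
    interval_cases n <;> norm_num
  · rw [p₀, if_neg (by omega)]
    induction n, h using Nat.le_induction with
    | base => norm_num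
    | succ n h ih =>
      have h1 : (n + 1) ^ 3 ≤ 2 * n ^ 3 := by
        obtain ⟨j, rfl⟩ := Nat.exists_eq_add_of_le h
        ring_nf
        nlinarith [sq_nonneg j]
      calc (n + 1) ^ 3 ≤ 2 * n ^ 3 := h1
        _ ≤ 2 * (2 * 2 ^ n) := by gcongr; exact ih (by omega)
        _ = _ := by ring

theorem log_m {n : ℕ} (hn : 6 ≤ n) :
    Real.log (m n) =
      Real.log 2 + Real.log (2 * n / (((n : ℝ) - 1) * ((n : ℝ) - 2))) / 2 := by
  have hn' : (6 : ℝ) ≤ n := by exact_mod_cast hn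
  have : 0 < 2 * (n : ℝ) / (((n : ℝ) - 1) * ((n : ℝ) - 2)) :=
    div_pos (by linarith) (mul_pos (by linarith) (by linarith))
  rw [m, Real.log_mul two_ne_zero (Real.sqrt_pos.2 this).ne', Real.log_sqrt this.le]

theorem log_r (n : ℕ) : Real.log (r n) = 1 / n * Real.log 2.032 := by
  rw [r, Real.log_rpow (by norm_num)]

/-- The logarithm of `(m_n / 2) r_n ^ d H ^ (-d / n) p ^ (d - n*) q ^ (-1 - d)`, which bounds the
distance from `p / q` to the root. -/
noncomputable def logBound (n : ℕ) (H d p q : ℝ) : ℝ :=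
  Real.log (m n) - Real.log 2 + d * Real.log (r n) - d / n * Real.log H
    - (nStar n - d) * Real.log p - (1 + d) * Real.log q

/-- The two distance estimates for a fraction `p / q` with `|f(p / q)| = q ^ (-n)`; the first one
improves with `p`, the second one with the height. -/
theorem sq_sub_root_le_and_le {α p q H : ℝ} (hN : 4 ≤ k + l) (ha : 1 ≤ a) (hα : 1 ≤ α)
    (hs : MonoSide a b k l (min α (p / q)) (max α (p / q))) (root : tri a b c k l α = 0)
    (hp : (p₀ (k + l + 2) : ℝ) ≤ p) (hq : 1 ≤ q) (hH0 : 1 ≤ H) (hH : H ≤ max a (max |b| |c|))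
    (hval : |tri a b c k l (p / q)| = 1 / q ^ (k + l + 2)) {M : ℝ}
    (hM : M = 2 * (k + l + 2) / (((k + l + 2 : ℝ) - 1) * ((k + l + 2 : ℝ) - 2))) :
    (p / q - α) ^ 2 ≤ M * (1 / p ^ (k + l + 2)) * (p / q) ^ 2 ∧
      (p / q - α) ^ 2 ≤ M * 2.032 / H / q ^ (k + l + 2) * (p / q) ^ 2 := by
  have hN' : (4 : ℝ) ≤ k + l := by exact_mod_cast hN
  have hq0 : 0 < q := by linarith
  have hp0 : (0 : ℝ) < p₀ (k + l + 2) := by unfold p₀; split_ifs <;> norm_num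
  have hpp : 0 < p := hp0.trans_le hp
  have hρ : 0 < p / q := by positivity
  have hcube : ((k : ℝ) + l + 2) ^ 3 * (1 / p ^ (k + l + 2)) ≤ 2 := by
    have h1 : (((k + l + 2 : ℕ)) ^ 3 : ℝ) ≤ 2 * (p₀ (k + l + 2) : ℝ) ^ (k + l + 2) := by
      exact_mod_cast cube_le_two_mul_p₀_pow (n := k + l + 2) (by omega)
    push_cast at h1
    rw [mul_one_div, div_le_iff₀ (by positivity)]
    exact h1.trans (by gcongr)
  have hM0 : 0 < ((k + l + 2 : ℝ) - 1) * ((k + l + 2 : ℝ) - 2) :=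
    mul_pos (by linarith) (by linarith)
  have h1 := sq_sub_root_le (ε := 1 / p ^ (k + l + 2)) hN ha (by linarith) hρ hs root
    (by positivity) hcube (by rw [hval, div_pow]; apply le_of_eq; field_simp)
  rw [← hM] at h1
  have hMpos : 0 < M := by rw [hM]; positivity
  have hMD : M * (((k + l + 2 : ℝ) - 1) * ((k + l + 2 : ℝ) - 2)) = 2 * (k + l + 2) := by
    rw [hM, div_mul_cancel₀ _ hM0.ne']
  have hE : 0 ≤ M * (1 / p ^ (k + l + 2)) := by positivity
  have hhalf : (k + l + 2) * √(M * (1 / p ^ (k + l + 2))) ≤ 1 / 2 := by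
    refine mul_le_half_of_sq_mul_le (by linarith) ?_
    rw [mul_pow, Real.sq_sqrt hE]
    calc (k + l + 2 : ℝ) ^ 2 * (M * (1 / p ^ (k + l + 2)))
          * ((k + l + 2 - 1) * (k + l + 2 - 2))
        = (k + l + 2 : ℝ) ^ 2 * (1 / p ^ (k + l + 2))
          * (M * ((k + l + 2 - 1) * (k + l + 2 - 2))) := by ring
      _ = 2 * ((k + l + 2 : ℝ) ^ 3 * (1 / p ^ (k + l + 2))) := by rw [hMD]; ring
      _ ≤ 4 := by linarith
  have hclose : |p / q - α| ≤ √(M * (1 / p ^ (k + l + 2))) * (p / q) := by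
    refine abs_le_of_sq_le_sq (h1.trans_eq ?_) (by positivity)
    rw [mul_pow, Real.sq_sqrt hE]
  have h2 := height_mul_sq_sub_root_le hN (by linarith) hα hρ hs root (by linarith : 0 ≤ H) hH
    (Real.sqrt_nonneg _) hhalf hclose
  refine ⟨h1, ?_⟩
  -- `4 / (n - 1) ≤ 2.032 * 2 n / ((n - 1) (n - 2))`: any constant `≥ 2` in place of
  -- `2.032` would do here
  have hk1 : 4 / (k + l + 1) ≤ M * 2.032 := by
    rw [hM, div_mul_eq_mul_div, div_le_div_iff₀ (by linarith) hM0]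
    nlinarith
  calc (p / q - α) ^ 2 = 4 / (k + l + 1) / H * ((k + l + 1) / 4 * H * (p / q - α) ^ 2) := by
        field_simp
    _ ≤ 4 / (k + l + 1) / H * (|tri a b c k l (p / q)| * (p / q) ^ 2) :=
      mul_le_mul_of_nonneg_left h2 (by positivity)
    _ ≤ M * 2.032 / H * (|tri a b c k l (p / q)| * (p / q) ^ 2) := by gcongr
    _ = _ := by rw [hval]; ring

/-- A weighted geometric mean of the two estimates of `sq_sub_root_le_and_le`. -/
theorem abs_sub_root_le_exp_logBound {α p q H d : ℝ} (hN : 4 ≤ k + l) (ha : 1 ≤ a) (hα : 1 ≤ α)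
    (hs : MonoSide a b k l (min α (p / q)) (max α (p / q))) (root : tri a b c k l α = 0)
    (hp : (p₀ (k + l + 2) : ℝ) ≤ p) (hq : 1 ≤ q) (hH0 : 1 ≤ H) (hH : H ≤ max a (max |b| |c|))
    (hval : |tri a b c k l (p / q)| = 1 / q ^ (k + l + 2)) (hd0 : 0 ≤ d)
    (hd : d ≤ nStar (k + l + 2)) :
    |p / q - α| ≤ Real.exp (logBound (k + l + 2) H d p q) := by
  have hN' : (4 : ℝ) ≤ k + l := by exact_mod_cast hN
  have hq0 : 0 < q := by linarith
  have hp0 : (0 : ℝ) < p₀ (k + l + 2) := by unfold p₀; split_ifs <;> norm_num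
  have hpp : 0 < p := hp0.trans_le hp
  obtain ⟨M, hM⟩ : ∃ M : ℝ,
    M = 2 * (k + l + 2) / (((k + l + 2 : ℝ) - 1) * ((k + l + 2 : ℝ) - 2)) := ⟨_, rfl⟩
  have hMpos : 0 < M := hM ▸ div_pos (by linarith) (mul_pos (by linarith) (by linarith))
  obtain ⟨h1, h2⟩ := sq_sub_root_le_and_le hN ha hα hs root hp hq hH0 hH hval hM
  rcases eq_or_ne (p / q - α) 0 with h0 | h0
  · rw [h0, abs_zero]
    exact (Real.exp_pos _).le
  have hΔ : 0 < |p / q - α| := abs_pos.2 h0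
  rw [← Real.log_le_iff_le_exp hΔ]
  have hn0 : ((k + l + 2 : ℕ) : ℝ) = k + l + 2 := by push_cast; ring
  have hlogρ : Real.log (p / q) = Real.log p - Real.log q := Real.log_div hpp.ne' hq0.ne'
  have hX : Real.log ((p / q - α) ^ 2) = 2 * Real.log |p / q - α| := by
    rw [← sq_abs, Real.log_pow]; norm_num
  have hL1 : 2 * Real.log |p / q - α| ≤
      Real.log M - (k + l + 2) * Real.log p + 2 * (Real.log p - Real.log q) := by
    rw [← hX, ← hlogρ]
    refine (Real.log_le_log (by positivity) h1).trans (le_of_eq ?_)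
    rw [Real.log_mul (by positivity) (by positivity), Real.log_mul (by positivity) (by positivity),
      one_div, Real.log_inv, Real.log_pow, Real.log_pow]
    push_cast
    ring
  have hL2 : 2 * Real.log |p / q - α| ≤ Real.log M + Real.log 2.032 - Real.log H
      - (k + l + 2) * Real.log q + 2 * (Real.log p - Real.log q) := by
    rw [← hX, ← hlogρ]
    refine (Real.log_le_log (by positivity) h2).trans (le_of_eq ?_)
    rw [Real.log_mul (by positivity) (by positivity), Real.log_div (by positivity) (by positivity),
      Real.log_div (by positivity) (by positivity), Real.log_mul (by positivity) (by norm_num),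
      Real.log_pow, Real.log_pow]
    push_cast
    ring
  -- interpolate between the two estimates with weights `1 - θ` and `θ`, where `θ = 2 d / n`
  have hnS : nStar (k + l + 2) = (k + l + 2) / 2 - 1 := by
    rw [nStar, hn0]; ring
  rw [hnS] at hd
  obtain ⟨θ, hθ⟩ : ∃ θ : ℝ, θ = 2 * d / (k + l + 2) := ⟨_, rfl⟩
  have hθ0 : 0 ≤ θ := by rw [hθ]; positivity
  have hθ1 : θ ≤ 1 := by
    rw [hθ, div_le_one (by positivity)]
    linarith
  have hθd : θ * (k + l + 2) = 2 * d := by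
    rw [hθ, div_mul_cancel₀ _ (by positivity)]
  have hdn : d / (k + l + 2) = θ / 2 := by rw [hθ]; ring
  have hdn' : d * (1 / (k + l + 2)) = θ / 2 := by rw [hθ]; ring
  have c1 := mul_le_mul_of_nonneg_left hL1 (sub_nonneg.2 hθ1)
  have c2 := mul_le_mul_of_nonneg_left hL2 hθ0
  rw [logBound, log_m (by omega), log_r, hn0, ← hM, ← mul_assoc, hdn, hdn', hnS]
  have e1 : θ * (k + l + 2) * Real.log p = 2 * d * Real.log p := by rw [hθd]
  have e2 : θ * (k + l + 2) * Real.log q = 2 * d * Real.log q := by rw [hθd]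
  linarith

end

/-! ### Gap principle -/

theorem two_le_p₀ (n : ℕ) : 2 ≤ p₀ n := by
  unfold p₀
  split_ifs <;> norm_num

theorem m_pos {n : ℕ} (hn : 6 ≤ n) : 0 < m n := by
  have hn' : (6 : ℝ) ≤ n := by exact_mod_cast hn
  have : 0 < 2 * (n : ℝ) / (((n : ℝ) - 1) * ((n : ℝ) - 2)) :=
    div_pos (by linarith) (mul_pos (by linarith) (by linarith))
  exact mul_pos two_pos (Real.sqrt_pos.2 this)

theorem r_pos (n : ℕ) : 0 < r n := Real.rpow_pos_of_pos (by norm_num) _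

theorem one_add_u_pos (n : ℕ) : 0 < 1 + u n :=
  add_pos_of_pos_of_nonneg one_pos (Real.sqrt_nonneg _)

theorem K_pos {n : ℕ} (hn : 6 ≤ n) (d : ℝ) : 0 < K d n :=
  mul_pos (m_pos hn) (Real.rpow_pos_of_pos (mul_pos (r_pos n) (one_add_u_pos n)) _)

theorem log_r_nonneg (n : ℕ) : 0 ≤ Real.log (r n) := by
  rw [log_r]
  exact mul_nonneg (by positivity) (Real.log_nonneg (by norm_num))

/-- `m_n r_n ^ d ≤ K_d(n)`: the factor `1 + u_n` only helps. -/
theorem log_m_add_le_log_K {n : ℕ} (hn : 6 ≤ n) {d : ℝ} (hd : 0 ≤ d) :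
    Real.log (m n) + d * Real.log (r n) ≤ Real.log (K d n) := by
  have h := mul_pos (r_pos n) (one_add_u_pos n)
  rw [K, Real.log_mul (m_pos hn).ne' (Real.rpow_pos_of_pos h _).ne', Real.log_rpow h,
    Real.log_mul (r_pos n).ne' (one_add_u_pos n).ne']
  have : 0 ≤ Real.log (1 + u n) := Real.log_nonneg (le_add_of_nonneg_right (Real.sqrt_nonneg _))
  nlinarith

theorem log_Q₁ {n : ℕ} (hn : 6 ≤ n) (d₀ : ℝ) :
    Real.log (Q₁ d₀ n) = (nStar n - d₀) * Real.log (p₀ n) - Real.log (K d₀ n) := by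
  have hp : (0 : ℝ) < p₀ n := by exact_mod_cast two_pos.trans_le (two_le_p₀ n)
  rw [Q₁, Real.log_div (Real.rpow_pos_of_pos hp _).ne' (K_pos hn _).ne', Real.log_rpow hp]

theorem logBound_le {n : ℕ} {H d : ℝ} {p q p' q' : ℝ} (hp : 0 < p) (hq : 0 < q) (hd0 : 0 ≤ d)
    (hd : d ≤ nStar n) (hpp : p ≤ p') (hqq : q ≤ q') :
    logBound n H d p' q' ≤ logBound n H d p q := by
  have h1 := mul_le_mul_of_nonneg_left (Real.log_le_log hp hpp) (sub_nonneg.2 hd)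
  have h2 := mul_le_mul_of_nonneg_left (Real.log_le_log hq hqq) (by linarith : 0 ≤ 1 + d)
  unfold logBound
  linarith

/-- The triangle inequality, in logarithmic form. -/
theorem log_le_of_le_abs_sub {α x ρ ρ' E : ℝ} (hx : 0 < x) (hdist : x ≤ |ρ - ρ'|)
    (h : |ρ - α| ≤ Real.exp E) (h' : |ρ' - α| ≤ Real.exp E) : Real.log x ≤ Real.log 2 + E := by
  have h1 : |ρ - ρ'| ≤ 2 * Real.exp E := by
    have := abs_sub_le ρ α ρ'
    rw [abs_sub_comm α ρ'] at this
    linarith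
  calc Real.log x ≤ Real.log (2 * Real.exp E) := Real.log_le_log hx (hdist.trans h1)
    _ = _ := by rw [Real.log_mul two_ne_zero (Real.exp_pos _).ne', Real.log_exp]

/-- Two distinct fractions differ by at least `1 / (q q')`, while both are close to `α`; so the larger
denominator exceeds a power of the smaller solution. -/
theorem gap_principle {n : ℕ} (hn : 6 ≤ n) {H d α : ℝ} {p q p' q' : ℤ} (hp : 0 < p) (hq : 0 < q)
    (hpp : p ≤ p') (hqq : q ≤ q') (hne : p * q' ≠ p' * q) (hd0 : 0 ≤ d) (hd : d ≤ nStar n)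
    (h : |(p / q : ℝ) - α| ≤ Real.exp (logBound n H d p q))
    (h' : |(p' / q' : ℝ) - α| ≤ Real.exp (logBound n H d p' q')) :
    (nStar n - d) * Real.log p + d * Real.log q + d / n * Real.log H - Real.log (K d n) ≤
      Real.log q' := by
  have hpR : (0 : ℝ) < p := by exact_mod_cast hp
  have hqR : (0 : ℝ) < q := by exact_mod_cast hq
  have hqR' : (0 : ℝ) < q' := by exact_mod_cast hq.trans_le hqq
  have hdist : 1 / ((q : ℝ) * q') ≤ |(p / q : ℝ) - p' / q'| := by
    rw [div_sub_div _ _ hqR.ne' hqR'.ne', abs_div, abs_of_pos (mul_pos hqR hqR')]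
    gcongr
    have : (1 : ℤ) ≤ |p * q' - q * p'| := Int.one_le_abs (by
      rw [mul_comm q]
      exact sub_ne_zero.2 hne)
    exact_mod_cast this
  have h1 := log_le_of_le_abs_sub (by positivity) hdist h (h'.trans (Real.exp_le_exp.2
    (logBound_le hpR hqR hd0 hd (by exact_mod_cast hpp) (by exact_mod_cast hqq))))
  rw [one_div, Real.log_inv, Real.log_mul hqR.ne' hqR'.ne'] at h1
  have h2 := log_m_add_le_log_K hn hd0
  unfold logBound at h1
  linarith

/-- Good approximations with increasing denominators have increasing numerators. -/
theorem numerator_le_of_denominator_le {n : ℕ} {H α : ℝ} {p q p' q' : ℤ} (hp : (p₀ n : ℤ) ≤ p)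
    (hp' : (p₀ n : ℤ) ≤ p') (hq : 0 < q) (hqq : q ≤ q') (hnS : 0 ≤ nStar n)
    (hm : Real.log (m n) < nStar n * Real.log (p₀ n))
    (h : |(p / q : ℝ) - α| ≤ Real.exp (logBound n H 0 p q))
    (h' : |(p' / q' : ℝ) - α| ≤ Real.exp (logBound n H 0 p' q')) : p ≤ p' := by
  by_contra! hlt
  have hp0 : (0 : ℝ) < p₀ n := by exact_mod_cast two_pos.trans_le (two_le_p₀ n)
  have hqR : (0 : ℝ) < q := by exact_mod_cast hq
  have hqR' : (0 : ℝ) < q' := by exact_mod_cast hq.trans_le hqq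
  have hqqR : (q : ℝ) ≤ q' := by exact_mod_cast hqq
  have hpR : (p₀ n : ℝ) ≤ p := by exact_mod_cast hp
  have hpR' : (p₀ n : ℝ) ≤ p' := by exact_mod_cast hp'
  have hltR : (p' : ℝ) + 1 ≤ p := by exact_mod_cast hlt
  have hdist : 1 / (q : ℝ) ≤ |(p / q : ℝ) - p' / q'| := by
    refine le_trans ?_ (le_abs_self _)
    have h1 : (p' : ℝ) / q' ≤ p' / q := by gcongr; linarith
    have h2 : ((p' : ℝ) + 1) / q ≤ p / q := by gcongr
    rw [add_div] at h2
    linarith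
  have h1 := log_le_of_le_abs_sub (by positivity) hdist
    (h.trans (Real.exp_le_exp.2 (logBound_le hp0 hqR le_rfl hnS hpR le_rfl)))
    (h'.trans (Real.exp_le_exp.2 (logBound_le hp0 hqR le_rfl hnS hpR' hqqR)))
  rw [one_div, Real.log_inv] at h1
  simp only [logBound, zero_mul, zero_div, sub_zero, add_zero, one_mul] at h1
  linarith

/-! ### Special solutions -/

theorem form_eval {n k : ℕ} {hn hk h0 p q : ℤ} :
    MvPolynomial.eval ![p, q] (form n k hn hk h0) =
      hn * p ^ n + hk * p ^ k * q ^ (n - k) + h0 * q ^ n := by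
  simp [form]

theorem dehom_form_eval {n k : ℕ} {hn hk h0 : ℤ} {x : ℝ} :
    (dehom (form n k hn hk h0)).eval x = hn * x ^ n + hk * x ^ k + h0 := by
  simp [dehom, form]

/-- A common divisor of `p` and `q` divides `F(p, q) = ±1`. -/
theorem IsSpecialSolution.isCoprime {n k : ℕ} {hn hk h0 p q : ℤ} (hk0 : 0 < k) (hkn : k < n)
    (hs : IsSpecialSolution n (form n k hn hk h0) p q) : IsCoprime p q := by
  rw [Int.isCoprime_iff_gcd_eq_one]
  have hd1 : ((Int.gcd p q : ℕ) : ℤ) ∣ p := Int.gcd_dvd_left ..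
  have hd2 : ((Int.gcd p q : ℕ) : ℤ) ∣ q := Int.gcd_dvd_right ..
  have h : ((Int.gcd p q : ℕ) : ℤ) ∣ MvPolynomial.eval ![p, q] (form n k hn hk h0) := by
    rw [form_eval]
    refine dvd_add (dvd_add ?_ ?_) ?_
    · exact Dvd.dvd.mul_left (dvd_pow hd1 (by omega)) _
    · exact Dvd.dvd.mul_right (Dvd.dvd.mul_left (dvd_pow hd1 hk0.ne') _) _
    · exact Dvd.dvd.mul_left (dvd_pow hd2 (by omega)) _
  have h1 := (dvd_abs _ _).2 h
  rw [hs.eqn] at h1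
  exact_mod_cast Int.eq_one_of_dvd_one (by positivity) h1

theorem eq_of_mul_eq_mul_of_isCoprime {p q p' q' : ℤ} (h : IsCoprime p q) (h' : IsCoprime p' q')
    (hp : 0 < p) (hp' : 0 < p') (he : p * q' = p' * q) : p = p' ∧ q = q' := by
  have h1 : p ∣ p' := h.dvd_of_dvd_mul_right (Dvd.intro _ he)
  have h2 : p' ∣ p := h'.dvd_of_dvd_mul_right (Dvd.intro _ he.symm)
  have h3 := Int.dvd_antisymm hp.le hp'.le h1 h2
  subst h3
  exact ⟨rfl, (mul_left_cancel₀ hp.ne' he).symm⟩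

theorem abs_sub_root_le_of_mem {n k : ℕ} {hn hk h0 : ℤ} (n_ge : 6 ≤ n) (k_pos : 0 < k)
    (k_lt : k < n) (hn_ne : hn ≠ 0) (h0_ne : h0 ≠ 0) {χ ϖ : ℝ} {c : ℕ} {τ : Fin c → ℝ}
    {η : Fin (c + 1) → EReal}
    (part : IsExceptionalPartition (dehom (form n k hn hk h0)) τ η) {i : Fin c}
    (one_lt_root : 1 < τ i) (root : (dehom (form n k hn hk h0)).eval (τ i) = 0) {s : ℤ × ℤ}
    (hs : s ∈ smallSpecialSolutions n k hn hk h0 χ ϖ η i) {d : ℝ} (hd0 : 0 ≤ d)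
    (hd : d ≤ nStar n) :
    |(s.1 / s.2 : ℝ) - τ i| ≤ Real.exp (logBound n (height hn hk h0) d s.1 s.2) := by
  obtain ⟨hsol, -, hbel⟩ := hs
  obtain ⟨k, rfl⟩ : ∃ k', k = k' + 1 := ⟨k - 1, by omega⟩
  obtain ⟨l, rfl⟩ : ∃ l, n = k + l + 2 := ⟨n - (k + 2), by omega⟩
  -- normalize the leading coefficient to be positive
  obtain ⟨σ, hσ, hσn⟩ : ∃ σ : ℤ, |σ| = 1 ∧ σ * hn = |hn| := by
    rcases le_total 0 hn with h | h
    · exact ⟨1, by simp, by rw [abs_of_nonneg h, one_mul]⟩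
    · exact ⟨-1, by simp, by rw [abs_of_nonpos h, neg_one_mul]⟩
  have hσ0 : σ ≠ 0 := fun h => by simp [h] at hσ
  have hσR : |(σ : ℝ)| = 1 := by exact_mod_cast hσ
  have hσ0R : (σ : ℝ) ≠ 0 := by exact_mod_cast hσ0
  have htri : ∀ x : ℝ, tri ((σ * hn : ℤ) : ℝ) ((σ * hk : ℤ) : ℝ) ((σ * h0 : ℤ) : ℝ) k l x
      = σ * (dehom (form (k + l + 2) (k + 1) hn hk h0)).eval x := fun x => by
    rw [dehom_form_eval, tri]
    push_cast
    ring
  have hq0 : (1 : ℝ) ≤ s.2 := by exact_mod_cast hsol.one_le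
  have hqpos : (0 : ℝ) < s.2 := by linarith
  have hp0 : (p₀ (k + l + 2) : ℝ) ≤ s.1 := by exact_mod_cast hsol.p₀_le
  have hppos : (0 : ℝ) < s.1 := by
    have := two_le_p₀ (k + l + 2)
    have h2 : (2 : ℝ) ≤ p₀ (k + l + 2) := by exact_mod_cast this
    linarith
  have ha : (1 : ℝ) ≤ ((σ * hn : ℤ) : ℝ) := by
    rw [hσn]
    exact_mod_cast Int.one_le_abs hn_ne
  have hval : |tri ((σ * hn : ℤ) : ℝ) ((σ * hk : ℤ) : ℝ) ((σ * h0 : ℤ) : ℝ) k l (s.1 / s.2)|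
      = 1 / (s.2 : ℝ) ^ (k + l + 2) := by
    have h1 := hsol.eqn
    rw [form_eval] at h1
    have h2 : |(hn : ℝ) * s.1 ^ (k + l + 2) + hk * s.1 ^ (k + 1) * s.2 ^ (l + 1)
        + h0 * s.2 ^ (k + l + 2)| = 1 := by
      rw [show k + l + 2 - (k + 1) = l + 1 by omega] at h1
      exact_mod_cast h1
    have e : (dehom (form (k + l + 2) (k + 1) hn hk h0)).eval ((s.1 : ℝ) / s.2) =
        ((hn : ℝ) * s.1 ^ (k + l + 2) + hk * s.1 ^ (k + 1) * s.2 ^ (l + 1)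
        + h0 * s.2 ^ (k + l + 2)) / s.2 ^ (k + l + 2) := by
      rw [dehom_form_eval, eq_div_iff (by positivity), div_pow, div_pow]
      field_simp
      ring
    rw [htri, abs_mul, hσR, one_mul, e, abs_div, h2, abs_of_pos (pow_pos hqpos _)]
  have hroot : tri ((σ * hn : ℤ) : ℝ) ((σ * hk : ℤ) : ℝ) ((σ * h0 : ℤ) : ℝ) k l (τ i) = 0 := by
    rw [htri, root, mul_zero]
  have hc : (1 : ℝ) ≤ |((σ * h0 : ℤ) : ℝ)| := by
    exact_mod_cast Int.one_le_abs (mul_ne_zero hσ0 h0_ne)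
  have hside := monoSide_of_belongsTo part hσ0R htri ha hc (by linarith) hroot
    (div_pos hppos hqpos) (by
      rw [hval, div_le_one (by positivity)]
      exact one_le_pow₀ hq0) hbel
  have hH1 : (1 : ℝ) ≤ (height hn hk h0 : ℝ) := by
    exact_mod_cast (Int.one_le_abs hn_ne).trans (le_max_left _ _)
  have hH : (height hn hk h0 : ℝ) ≤
      max ((σ * hn : ℤ) : ℝ) (max |((σ * hk : ℤ) : ℝ)| |((σ * h0 : ℤ) : ℝ)|) := by
    rw [hσn]
    push_cast
    rw [abs_mul, abs_mul, hσR, one_mul, one_mul, height]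
    push_cast
    rfl
  exact abs_sub_root_le_exp_logBound (by omega) ha one_lt_root.le hside hroot hp0 hq0 hH1 hH hval
    hd0 hd

/-! ### Counting -/

/-- Among `j + 2` elements, the one with the largest denominator satisfies the bound obtained by
iterating the gap principle `j` times, starting from the second smallest. -/
theorem chain_bound {S : Set (ℤ × ℤ)} {d a₀ L : ℝ} {t : Finset (ℤ × ℤ)} {j : ℕ}
    (ht : (t : Set (ℤ × ℤ)) ⊆ S) (hcard : t.card = j + 2) (hd : 0 < d)
    (hfirst : ∀ x ∈ S, ∀ y ∈ S, x ≠ y → x.2 ≤ y.2 → a₀ ≤ Real.log y.2)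
    (hnext : ∀ x ∈ S, ∀ y ∈ S, x ≠ y → x.2 ≤ y.2 →
      d * Real.log x.2 + (d - 1) * L - (d - 1) * a₀ ≤ Real.log y.2) :
    ∃ x ∈ t, (d ^ j - 1) * L + a₀ ≤ Real.log x.2 := by
  induction j generalizing t with
  | zero =>
    obtain ⟨x, hx, hmax⟩ := t.exists_max_image (fun s => s.2)
      (Finset.card_pos.1 (by omega))
    obtain ⟨y, hy, hne⟩ := Finset.exists_mem_ne (by omega : 1 < t.card) x
    refine ⟨x, hx, ?_⟩
    simpa using hfirst y (ht hy) x (ht hx) hne (hmax y hy)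
  | succ j ih =>
    obtain ⟨x, hx, hmax⟩ := t.exists_max_image (fun s => s.2)
      (Finset.card_pos.1 (by omega))
    obtain ⟨y, hy, hyb⟩ := ih (t := t.erase x)
      ((Finset.coe_subset.2 (t.erase_subset x)).trans ht)
      (by rw [Finset.card_erase_of_mem hx]; omega)
    have hyt := Finset.mem_of_mem_erase hy
    have h1 := hnext y (ht hyt) x (ht hx) (Finset.ne_of_mem_erase hy) (hmax y hyt)
    refine ⟨x, hx, ?_⟩
    have h2 := mul_le_mul_of_nonneg_left hyb hd.le
    rw [pow_succ]
    linarith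

theorem finite_and_ncard_le {S : Set (ℤ × ℤ)} {T : ℤ} (hT : 0 ≤ T)
    (h : ∀ t : Finset (ℤ × ℤ), (t : Set (ℤ × ℤ)) ⊆ S → (t.card : ℤ) ≤ T) :
    S.Finite ∧ (S.ncard : ℤ) ≤ T := by
  have hfin : S.Finite := by
    by_contra hinf
    obtain ⟨t, ht, hcard⟩ := Set.Infinite.exists_subset_card_eq hinf (T.toNat + 1)
    have := h t ht
    omega
  refine ⟨hfin, ?_⟩
  rw [Set.ncard_eq_toFinset_card S hfin]
  exact h _ (by simp)

theorem lt_pow_of_log_div_log_lt {x d : ℝ} {j : ℕ} (hx : 0 < x) (hd : 1 < d)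
    (h : Real.log x / Real.log d < j) : x < d ^ j := by
  rw [div_lt_iff₀ (Real.log_pos hd), ← Real.log_pow] at h
  exact (Real.log_lt_log_iff hx (pow_pos (by linarith) _)).1 h

end TrinomialThue

theorem mainTheorem6
    (n k : ℕ) (hn hk h0 : ℤ) (n_ge : 6 ≤ n) (k_pos : 0 < k) (k_lt : k < n)
    (hn_ne : hn ≠ 0) (hk_ne : hk ≠ 0) (h0_ne : h0 ≠ 0)
    (irred : Irreducible (TrinomialThue.form n k hn hk h0))
    -- the exponents `χ_n` and `π_n` in `Y_F = H^(χ_n) e^(π_n)`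
    (χ ϖ : ℝ) (χ_nonneg : 0 ≤ χ) (ϖ_nonneg : 0 ≤ ϖ)
    -- the parameters
    (d₀ d : ℝ) (d₀_nonneg : 0 ≤ d₀) (d₀_le : d₀ ≤ TrinomialThue.nStar n - 1.4)
    (one_lt_d : 1 < d) (d_le : d ≤ TrinomialThue.nStar n)
    (Q₁_size : max 1 (TrinomialThue.K d n) < TrinomialThue.Q₁ d₀ n ^ (d - 1))
    -- the exceptional points of `f`, separated by improper critical points
    {c : ℕ} (τ : Fin c → ℝ) (η : Fin (c + 1) → EReal)
    (part : TrinomialThue.IsExceptionalPartition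
      (TrinomialThue.dehom (TrinomialThue.form n k hn hk h0)) τ η)
    -- the real root `α = τ i > 1` of `f`
    (i : Fin c) (one_lt_root : 1 < τ i)
    (root : (TrinomialThue.dehom (TrinomialThue.form n k hn hk h0)).eval (τ i) = 0) :
    (TrinomialThue.smallSpecialSolutions n k hn hk h0 χ ϖ η i).Finite ∧
      ((TrinomialThue.smallSpecialSolutions n k hn hk h0 χ ϖ η i).ncard : ℤ) ≤
        TrinomialThue.T n d₀ d χ ϖ := by
  open TrinomialThue in
  have hd1 : 0 < d - 1 := by linarith
  have hn0 : (0 : ℝ) < n := by exact_mod_cast (by omega : 0 < n)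
  have hnS : 0 ≤ nStar n := by linarith
  have hp0 : (0 : ℝ) < p₀ n := by exact_mod_cast two_pos.trans_le (two_le_p₀ n)
  have hQ0 : 0 < Q₁ d₀ n := div_pos (Real.rpow_pos_of_pos hp0 _) (K_pos n_ge _)
  have hlogQ : Real.log (Q₁ d₀ n ^ (d - 1)) = (d - 1) * Real.log (Q₁ d₀ n) := Real.log_rpow hQ0 _
  have hQpos : 0 < Real.log (Q₁ d₀ n) := by
    have h1 := Real.log_pos ((le_max_left _ _).trans_lt Q₁_size)
    rw [hlogQ] at h1
    exact pos_of_mul_pos_right h1 hd1.le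
  have hKQ : Real.log (K d n) < (d - 1) * Real.log (Q₁ d₀ n) := by
    rw [← hlogQ]
    exact Real.log_lt_log (K_pos n_ge d) ((le_max_right _ _).trans_lt Q₁_size)
  set H : ℝ := (height hn hk h0 : ℝ) with hHdef
  have hH1 : 1 ≤ H := by
    rw [hHdef]
    exact_mod_cast (Int.one_le_abs hn_ne).trans (le_max_left _ _)
  have hlogH : 0 ≤ Real.log H := Real.log_nonneg hH1
  -- each application of the gap principle multiplies `log q` by `d`; after `j` of them,
  -- `log q ≥ (d ^ j - 1) (L + A log H) + log Q₁ + (d₀ / n) log H`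
  obtain ⟨A, hA⟩ : ∃ A, A = (d₀ * (d - 1) + d) / (n * (d - 1)) := ⟨_, rfl⟩
  have hApos : 0 < A := by rw [hA]; positivity
  have hAmul : (d - 1) * A = (d - 1) * (d₀ / n) + d / n := by
    rw [hA]
    field_simp
  obtain ⟨L, hL⟩ : ∃ L, L = Real.log (K d n ^ (-1 / (d - 1)) * Q₁ d₀ n) := ⟨_, rfl⟩
  have hLmul : (d - 1) * L = (d - 1) * Real.log (Q₁ d₀ n) - Real.log (K d n) := by
    rw [hL, Real.log_mul (Real.rpow_pos_of_pos (K_pos n_ge d) _).ne' hQ0.ne',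
      Real.log_rpow (K_pos n_ge d)]
    field_simp
    ring
  have hLpos : 0 < L := by
    have h : 0 < (d - 1) * L := by
      rw [hLmul]
      linarith
    exact pos_of_mul_pos_right h hd1.le
  set S := smallSpecialSolutions n k hn hk h0 χ ϖ η i with hS
  have happrox : ∀ s ∈ S, ∀ e : ℝ, 0 ≤ e → e ≤ nStar n →
      |(s.1 / s.2 : ℝ) - τ i| ≤ Real.exp (logBound n H e s.1 s.2) := fun s hs e he he' =>
    abs_sub_root_le_of_mem n_ge k_pos k_lt hn_ne h0_ne part one_lt_root root hs he he'
  have hp_pos : ∀ s ∈ S, 0 < s.1 := fun s hs => by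
    have h1 := hs.1.one_le
    have h2 := hs.1.lt
    omega
  have hq_pos : ∀ s ∈ S, 0 < s.2 := fun s hs => hs.1.one_le
  -- `Q₁ > 1` says that `K_{d₀}(n) < p₀ ^ (n* - d₀)`
  have hm : Real.log (m n) < nStar n * Real.log (p₀ n) := by
    have h1 := log_m_add_le_log_K n_ge d₀_nonneg
    have h2 := log_Q₁ n_ge d₀
    have h3 := mul_nonneg d₀_nonneg (log_r_nonneg n)
    have h4 : 0 ≤ d₀ * Real.log (p₀ n) :=
      mul_nonneg d₀_nonneg (Real.log_nonneg (by exact_mod_cast one_le_two.trans (two_le_p₀ n)))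
    linarith
  have hgap : ∀ x ∈ S, ∀ y ∈ S, x ≠ y → x.2 ≤ y.2 → ∀ e : ℝ, 0 ≤ e → e ≤ nStar n →
      (nStar n - e) * Real.log x.1 + e * Real.log x.2 + e / n * Real.log H - Real.log (K e n) ≤
        Real.log y.2 := by
    intro x hx y hy hne hle e he he'
    refine gap_principle n_ge (hp_pos x hx) (hq_pos x hx) ?_ hle ?_ he he' (happrox x hx e he he')
      (happrox y hy e he he')
    · exact numerator_le_of_denominator_le hx.1.p₀_le hy.1.p₀_le (hq_pos x hx) hle hnS hm
        (happrox x hx 0 le_rfl hnS) (happrox y hy 0 le_rfl hnS)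
    · intro heq
      obtain ⟨h1, h2⟩ := eq_of_mul_eq_mul_of_isCoprime (hx.1.isCoprime k_pos k_lt)
        (hy.1.isCoprime k_pos k_lt) (hp_pos x hx) (hp_pos y hy) heq
      exact hne (Prod.ext h1 h2)
  have hlogq : ∀ x ∈ S, 0 ≤ Real.log x.2 := fun x hx =>
    Real.log_nonneg (by exact_mod_cast hx.1.one_le)
  have hfirst : ∀ x ∈ S, ∀ y ∈ S, x ≠ y → x.2 ≤ y.2 →
      Real.log (Q₁ d₀ n) + d₀ / n * Real.log H ≤ Real.log y.2 := by
    intro x hx y hy hne hle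
    have h1 := hgap x hx y hy hne hle d₀ d₀_nonneg (by linarith)
    have h2 := mul_nonneg d₀_nonneg (hlogq x hx)
    have h3 : (nStar n - d₀) * Real.log (p₀ n) ≤ (nStar n - d₀) * Real.log x.1 :=
      mul_le_mul_of_nonneg_left (Real.log_le_log hp0 (by exact_mod_cast hx.1.p₀_le)) (by linarith)
    rw [log_Q₁ n_ge]
    linarith
  have hnext : ∀ x ∈ S, ∀ y ∈ S, x ≠ y → x.2 ≤ y.2 →
      d * Real.log x.2 + (d - 1) * (L + A * Real.log H)
        - (d - 1) * (Real.log (Q₁ d₀ n) + d₀ / n * Real.log H) ≤ Real.log y.2 := by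
    intro x hx y hy hne hle
    have h1 := hgap x hx y hy hne hle d (by linarith) d_le
    have h2 : 0 ≤ (nStar n - d) * Real.log x.1 :=
      mul_nonneg (by linarith) (Real.log_nonneg (by exact_mod_cast hp_pos x hx))
    have h3 : (d - 1) * (A * Real.log H) =
        ((d - 1) * (d₀ / n) + d / n) * Real.log H := by rw [← hAmul]; ring
    linarith
  have hMχ : 0 ≤ Real.log (χ / A + 1) / Real.log d :=
    div_nonneg (Real.log_nonneg (by linarith [div_nonneg χ_nonneg hApos.le]))
      (Real.log_pos one_lt_d).le
  have hT : T n d₀ d χ ϖ = ⌊max (Real.log (χ / A + 1) / Real.log d)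
      (Real.log (ϖ / L + 1) / Real.log d)⌋ + 2 := by
    rw [T, hA, hL]
  have hfloor : 0 ≤ ⌊max (Real.log (χ / A + 1) / Real.log d)
      (Real.log (ϖ / L + 1) / Real.log d)⌋ := Int.floor_nonneg.2 (hMχ.trans (le_max_left _ _))
  refine finite_and_ncard_le (by omega) fun t ht => ?_
  by_contra! hlt
  obtain ⟨j, hj⟩ : ∃ j, t.card = j + 2 := ⟨t.card - 2, by omega⟩
  rw [hT, hj] at hlt
  have hMj : max (Real.log (χ / A + 1) / Real.log d) (Real.log (ϖ / L + 1) / Real.log d)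
      < (j : ℝ) := by
    have := Int.floor_lt.1 (show ⌊max (Real.log (χ / A + 1) / Real.log d)
      (Real.log (ϖ / L + 1) / Real.log d)⌋ < (j : ℤ) by push_cast at hlt; omega)
    exact_mod_cast this
  have hχ := lt_pow_of_log_div_log_lt
    (by linarith [div_nonneg χ_nonneg hApos.le]) one_lt_d ((le_max_left _ _).trans_lt hMj)
  have hϖ := lt_pow_of_log_div_log_lt
    (by linarith [div_nonneg ϖ_nonneg hLpos.le]) one_lt_d ((le_max_right _ _).trans_lt hMj)
  obtain ⟨x, hx, hbig⟩ := chain_bound ht hj (by linarith) hfirst hnext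
  have hsmall : Real.log x.2 ≤ χ * Real.log H + ϖ := by
    have hqx : (0 : ℝ) < x.2 := by exact_mod_cast hq_pos x (ht hx)
    refine (Real.log_le_log hqx (ht hx).2.1).trans (le_of_eq ?_)
    rw [Y, Real.log_mul (Real.rpow_pos_of_pos (by linarith) _).ne' (Real.exp_pos _).ne',
      Real.log_rpow (by linarith), Real.log_exp]
  have h1 : χ * Real.log H ≤ (d ^ j - 1) * (A * Real.log H) := by
    rw [← mul_assoc]
    refine mul_le_mul_of_nonneg_right ?_ hlogH
    rw [← div_le_iff₀ hApos]
    linarith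
  have h2 : ϖ < (d ^ j - 1) * L := by
    rw [← div_lt_iff₀ hLpos]
    linarith
  have h3 : 0 ≤ d₀ / n * Real.log H := by positivity
  linarith
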